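/- Let $L_1,L_2>0$, let $\mathbb T^2=\mathbb R/L_1\mathbb Z\times\mathbb R/L_2\mathbb Z$ with normalized Lebesgue measure, and for $\mathbf k=(k_1,k_2)\in\mathbb Z^2$ put $\widetilde{\mathbf k}=2\pi(k_1/L_1,k_2/L_2)$. Write $\hat f(\mathbf k)$ for the Fourier coefficients of $f$ with respect to $e^{i\widetilde{\mathbf k}\cdot\mathbf x}$ (so that $\|f\|_{L^2}^2=\sum_{\mathbf k}|\hat f(\mathbf k)|^2$), $H^s=\{f\in L^2:\sum_{\mathbf k}(1+|\widetilde{\mathbf k}|^2)^s|\hat f(\mathbf k)|^2<\infty\}$ and $\|f\|_{\dot H^s}^2=\sum_{\mathbf k\neq 0}|\widetilde{\mathbf k}|^{2s}|\hat f(\mathbf k)|^2$. Let $\mathcal L=\Delta^2+\Delta$, so that $e^{-t\mathcal L}$ is the Fourier multiplier with symbol $e^{-t(|\widetilde{\mathbf k}|^4-|\widetilde{\mathbf k}|^2)}$. A mild solution on $[0,T)$ of the two-dimensional Kuramoto--Sivashinsky system (2DKS) $\mathbf u_t+\nabla(|\mathbf u|^2/2)=-\Delta^2\mathbf u-\Delta\mathbf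 u$ with initial data $\mathbf u_0\in L^2(\mathbb T^2;\mathbb R^2)$ is a function $\mathbf u\in C([0,T);L^2(\mathbb T^2;\mathbb R^2))$ such that $$\mathbf u(t)=e^{-t\mathcal L}\mathbf u_0-\int_0^t e^{-(t-\tau)\mathcal L}\,\nabla\Big(\frac{|\mathbf u(\tau)|^2}{2}\Big)\,d\tau\qquad\text{for all }t\in[0,T),$$ the integral being a convergent Bochner integral in $L^2$. **Theorem.** For every $\mathbf u_0\in L^2(\mathbb T^2;\mathbb R^2)$ there are $0<T<\infty$ and a unique mild solution $\mathbf u\in C([0,T);L^2)$ of 2DKS on $[0,T)$ with initial data $\mathbf u_0$. Moreover, for every $0\le s<5/3$, $\mathbf u(t)\in H^s$ for all $t\in(0,T)$, and $$\sup_{0<t<T}e^{-t}\,t^{s/4}\,\|\mathbf u(t)\|_{\dot H^s}\le C(L_1,L_2,s,\|\mathbf u_0\|_{L^2}),$$ where the constant $C$ depends only on the quantities indicated. The time $T$ and the solution do not depend on $s$. -/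

import Mathlib

open MeasureTheory

noncomputable section

namespace KS2D

/-- The torus of periods `L₁`, `L₂`, that is `ℝ/L₁ℤ × ℝ/L₂ℤ`. -/
abbrev Torus (L₁ L₂ : ℝ) : Type := AddCircle L₁ × AddCircle L₂

section

variable (L₁ L₂ : ℝ) [Fact (0 < L₁)] [Fact (0 < L₂)]

/-- Normalized Lebesgue measure `dx dy / (L₁ L₂)` on the torus. With this normalization
Plancherel's formula reads `‖f‖²_{L²} = ∑ |f̂(k)|²`. -/
abbrev torusMeasure : Measure (Torus L₁ L₂) :=
  (AddCircle.haarAddCircle (T := L₁)).prod (AddCircle.haarAddCircle (T := L₂))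

/-- `L²(𝕋²; ℝ²)`: square integrable real vector fields `𝐮 = (u, v)` on the torus. -/
abbrev L2Field : Type := Lp (EuclideanSpace ℝ (Fin 2)) 2 (torusMeasure L₁ L₂)

/-- `L²(𝕋²; ℂ)`. -/
abbrev L2Complex : Type := Lp ℂ 2 (torusMeasure L₁ L₂)

end

section

variable (L₁ L₂ : ℝ)

/-- The character `e_k(x, y) = exp (2πi (k₁ x / L₁ + k₂ y / L₂))`. -/
def character (k : ℤ × ℤ) : C(Torus L₁ L₂, ℂ) where
  toFun x := fourier k.1 x.1 * fourier k.2 x.2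

/-- The wave vector `k̃ = 2π (k₁ / L₁, k₂ / L₂)`. -/
def waveVec (k : ℤ × ℤ) : Fin 2 → ℝ :=
  ![2 * Real.pi * k.1 / L₁, 2 * Real.pi * k.2 / L₂]

/-- `|k̃|²`. -/
def waveSq (k : ℤ × ℤ) : ℝ := waveVec L₁ L₂ k 0 ^ 2 + waveVec L₁ L₂ k 1 ^ 2

/-- The symbol `σ(k) = |k̃|⁴ - |k̃|²` of `ℒ = Δ² + Δ`. -/
def symbol (k : ℤ × ℤ) : ℝ := waveSq L₁ L₂ k ^ 2 - waveSq L₁ L₂ k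

end

section

variable {L₁ L₂ : ℝ} [Fact (0 < L₁)] [Fact (0 < L₂)]

/-- The Fourier coefficient `f̂(k) = (L₁ L₂)⁻¹ ∫ f e_{-k}`, so that `f = ∑ f̂(k) e_k`. -/
def coeff (f : Torus L₁ L₂ → ℂ) (k : ℤ × ℤ) : ℂ :=
  ∫ x, character L₁ L₂ (-k) x * f x ∂(torusMeasure L₁ L₂)

/-- The character `e_k` as an element of `L²`. -/
def characterL2 (k : ℤ × ℤ) : L2Complex L₁ L₂ :=
  ContinuousMap.toLp 2 (torusMeasure L₁ L₂) ℂ (character L₁ L₂ k)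

/-- The Fourier multiplier with symbol `m`: `f ↦ 𝓕⁻¹(m f̂) = ∑ m(k) f̂(k) e_k`, the series being
summed in `L²`. It is meaningful for every integrable `f` with `m f̂` square summable. -/
def multiplier (m : ℤ × ℤ → ℂ) (f : Torus L₁ L₂ → ℂ) : L2Complex L₁ L₂ :=
  ∑' k : ℤ × ℤ, (m k * coeff f k) • characterL2 k

/-- The semigroup `e^{-tℒ}`, with symbol `e^{-tσ(k)}`. -/
def semigroup (t : ℝ) (f : Torus L₁ L₂ → ℂ) : L2Complex L₁ L₂ :=
  multiplier (fun k => (Real.exp (-t * symbol L₁ L₂ k) : ℂ)) f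

/-- The operator `e^{-tℒ} ∂_j`, with symbol `e^{-tσ(k)} i k̃_j`. -/
def semigroupDeriv (t : ℝ) (j : Fin 2) (f : Torus L₁ L₂ → ℂ) : L2Complex L₁ L₂ :=
  multiplier
    (fun k => (Real.exp (-t * symbol L₁ L₂ k) : ℂ) * (Complex.I * (waveVec L₁ L₂ k j : ℂ))) f

/-- The `j`-th component of a real vector field, regarded as a complex `L²` function. -/
def component (j : Fin 2) (w : L2Field L₁ L₂) : L2Complex L₁ L₂ :=
  (Complex.ofRealCLM.comp (EuclideanSpace.proj (𝕜 := ℝ) j)).compLp w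

/-- The function `|𝐮|² / 2`, which is integrable for `𝐮 ∈ L²`. -/
def halfSq (w : L2Field L₁ L₂) : Torus L₁ L₂ → ℂ :=
  fun x => ((‖w x‖ ^ 2 / 2 : ℝ) : ℂ)

/-- `u` is a mild solution of the two-dimensional Kuramoto--Sivashinsky system on `[0, T)` with
initial datum `u₀`, of class `C([0, T); L²)`: for all `t ∈ [0, T)`, componentwise in `L²`,
`u(t) = e^{-tℒ} u₀ - ∫₀ᵗ e^{-(t-τ)ℒ} ∇(|u(τ)|²/2) dτ`
with a (convergent) Bochner integral in `L²`. -/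
structure IsMildSolution (T : ℝ) (u₀ : L2Field L₁ L₂) (u : ℝ → L2Field L₁ L₂) : Prop where
  continuousOn : ContinuousOn u (Set.Ico 0 T)
  integrable : ∀ t ∈ Set.Ico 0 T, ∀ j : Fin 2,
    IntervalIntegrable (fun τ : ℝ => semigroupDeriv (t - τ) j (halfSq (u τ))) volume 0 t
  duhamel : ∀ t ∈ Set.Ico 0 T, ∀ j : Fin 2,
    component j (u t) = semigroup t (component j u₀)
      - ∫ τ in (0 : ℝ)..t, semigroupDeriv (t - τ) j (halfSq (u τ))

/-- `|𝐮̂(k)|² = |û(k)|² + |v̂(k)|²`. -/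
def coeffSq (w : L2Field L₁ L₂) (k : ℤ × ℤ) : ℝ :=
  ∑ j : Fin 2, ‖coeff (component j w) k‖ ^ 2

/-- Membership in `H^s`: `∑ (1 + |k̃|²)^s |𝐮̂(k)|² < ∞`. -/
def MemHs (s : ℝ) (w : L2Field L₁ L₂) : Prop :=
  Summable fun k : ℤ × ℤ => (1 + waveSq L₁ L₂ k) ^ s * coeffSq w k

/-- The homogeneous norm `‖𝐮‖_{Ḣ^s} = (∑_{k ≠ 0} |k̃|^{2s} |𝐮̂(k)|²)^{1/2}`, for `𝐮 ∈ H^s`. -/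
def homNorm (s : ℝ) (w : L2Field L₁ L₂) : ℝ :=
  Real.sqrt (∑' k : {k : ℤ × ℤ // k ≠ 0}, waveSq L₁ L₂ k ^ s * coeffSq w k)

end

end KS2D

end

/-!
For `u ∈ L²` the nonlinearity `|u|²/2` is only integrable, so its Fourier coefficients are merely
bounded, by `‖u‖²/2`. The fourth-order dissipation makes up for this. For `t ≤ 1` the symbol of
`e^{-tℒ} ∂_j` is at most `C t^{-3/4} |k̃|⁻²` (`norm_derivSymbol_sq_le`), and `∑ |k̃|⁻⁴` converges on
a two-dimensional lattice, whence `‖e^{-tℒ} ∂_j (|u|²/2)‖ ≤ K t^{-3/4} ‖u‖²/2`. The singularity is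
integrable, so the Duhamel integral converges in `L²` and is Lipschitz on balls with a constant
`O(T^{1/4})` (`norm_duhamel_sub_le`). A contraction argument in `C([0, T]; L²)` gives the solution
(`exists_fixedPoint_duhamelMap`). Uniqueness among all continuous mild solutions comes from
the same estimate in the weighted norm `sup e^{-λt} ‖·‖` (`IsMildSolution.eqOn`).

Regularity needs no fixed point in a smoother space. Integrating the symbol in time instead of
estimating it pointwise, the `k`-th coefficient of the Duhamel integral is `O(‖u‖² |k̃|⁻³)`
uniformly in `t ≤ 1` (`norm_coeff_duhamel_le`), and `∑ |k̃|^{2s - 6}` converges for all `s < 2`, in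
particular for `s < 5/3`. The free evolution satisfies `t^{s/4} |k̃|^s e^{-tσ(k)} ≤ C`
(`memHs_and_homNorm_le`).

The only fact used about the characters is that they are orthonormal: semigroup and Duhamel
integral take values in their closed span, and Bessel's inequality bounds the coefficients of the
datum. The fixed point is constructed from real parts (`toField`), and since the symbols are
Hermitian and the data real, the right-hand side of the Duhamel formula is itself real
(`component_duhamelMap`).
-/

open MeasureTheory

noncomputable section

namespace KS2D

/-! ### Orthonormal series in a Hilbert space -/

section Orthonormal

variable {ι E : Type*} [NormedAddCommGroup E] [InnerProductSpace ℂ E] [CompleteSpace E]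
  {e : ι → E} {c d : ι → ℂ}

lemma summable_smul_of_orthonormal (he : Orthonormal ℂ e) (hc : Summable fun k => ‖c k‖ ^ 2) :
    Summable fun k => c k • e k := by
  simpa using (he.orthogonalFamily.summable_iff_norm_sq_summable c).2 hc

lemma inner_tsum_smul (he : Orthonormal ℂ e) (hc : Summable fun k => ‖c k‖ ^ 2) (k : ι) :
    inner ℂ (e k) (∑' l, c l • e l) = c k := by
  classical
  have h := (summable_smul_of_orthonormal he hc).hasSum.mapL (innerSL ℂ (e k))
  have h2 : (fun l => innerSL ℂ (e k) (c l • e l)) = fun l => if l = k then c k else 0 := by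
    funext l
    rw [innerSL_apply_apply, inner_smul_right, orthonormal_iff_ite.1 he k l]
    by_cases hl : l = k
    · simp [hl]
    · simp [hl, Ne.symm hl]
  rw [h2] at h
  exact h.unique (hasSum_ite_eq k (c k))

lemma norm_sq_tsum_smul (he : Orthonormal ℂ e) (hc : Summable fun k => ‖c k‖ ^ 2) :
    ‖∑' k, c k • e k‖ ^ 2 = ∑' k, ‖c k‖ ^ 2 := by
  have h := (summable_smul_of_orthonormal he hc).hasSum
  have h1 := (h.norm.pow 2)
  have h2 : (fun s : Finset ι => ‖∑ k ∈ s, c k • e k‖ ^ 2) = fun s => ∑ k ∈ s, ‖c k‖ ^ 2 := by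
    funext s
    simpa using he.orthogonalFamily.norm_sum c s
  rw [h2] at h1
  exact tendsto_nhds_unique h1 hc.hasSum

lemma tsum_smul_sub (he : Orthonormal ℂ e) (hc : Summable fun k => ‖c k‖ ^ 2)
    (hd : Summable fun k => ‖d k‖ ^ 2) :
    (∑' k, c k • e k) - ∑' k, d k • e k = ∑' k, (c k - d k) • e k := by
  rw [← (summable_smul_of_orthonormal he hc).tsum_sub (summable_smul_of_orthonormal he hd)]
  simp [sub_smul]

/-- The orthogonal projection onto the closed span of an orthonormal family commutes with the
Bochner integral, so that the integral of a function with values in that closed span is the sum of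
its own Fourier series. -/
lemma intervalIntegral_eq_tsum_smul (he : Orthonormal ℂ e) {F : ℝ → E} {a b : ℝ}
    (hF : IntervalIntegrable F volume a b) {c : ℝ → ι → ℂ}
    (hc : ∀ᵐ τ, τ ∈ Set.uIoc a b →
      (Summable fun k => ‖c τ k‖ ^ 2) ∧ F τ = ∑' k, c τ k • e k) :
    (∫ τ in a..b, F τ) = ∑' k, (∫ τ in a..b, c τ k) • e k := by
  classical
  set U := he.orthogonalFamily.linearIsometry with hU
  have hUsum : ∀ x : lp (fun _ : ι => ℂ) 2, HasSum (fun k => x k • e k) (U x) := fun x => by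
    simpa using he.orthogonalFamily.hasSum_linearIsometry x
  set P : E →L[ℂ] E := U.toContinuousLinearMap ∘L
    ContinuousLinearMap.adjoint U.toContinuousLinearMap with hP
  have hUU : ∀ x, ContinuousLinearMap.adjoint U.toContinuousLinearMap (U x) = x := by
    intro x
    refine ext_inner_left ℂ fun y => ?_
    rw [ContinuousLinearMap.adjoint_inner_right]
    exact U.inner_map_map y x
  have hfix : ∀ᵐ τ, τ ∈ Set.uIoc a b → P (F τ) = F τ := by
    filter_upwards [hc] with τ hτ hm
    obtain ⟨h1, h2⟩ := hτ hm
    have hmem : Memℓp (c τ) 2 := memℓp_gen (by simpa using h1)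
    have h3 : F τ = U ⟨c τ, hmem⟩ := by
      rw [h2]; exact (hUsum ⟨c τ, hmem⟩).tsum_eq
    rw [h3, hP]
    simp [hUU]
  have hI : P (∫ τ in a..b, F τ) = ∫ τ in a..b, F τ := by
    rw [← P.intervalIntegral_comp_comm hF]
    exact intervalIntegral.integral_congr_ae hfix
  set x := ContinuousLinearMap.adjoint U.toContinuousLinearMap (∫ τ in a..b, F τ) with hx
  have h1 : (∫ τ in a..b, F τ) = ∑' k, x k • e k := by
    rw [(hUsum x).tsum_eq]; exact hI.symm
  have hxs : Summable fun k => ‖x k‖ ^ 2 := by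
    simpa using (lp.memℓp x).summable (by simp)
  have h2 : ∀ k, x k = ∫ τ in a..b, c τ k := by
    intro k
    rw [← inner_tsum_smul he hxs k, ← h1]
    have := (innerSL ℂ (e k)).intervalIntegral_comp_comm hF
    simp only [innerSL_apply_apply] at this
    rw [← this]
    refine intervalIntegral.integral_congr_ae ?_
    filter_upwards [hc] with τ hτ hm
    obtain ⟨h3, h4⟩ := hτ hm
    rw [h4, inner_tsum_smul he h3]
  rw [h1]
  simp only [h2]

/-- An orthonormal series depends continuously on a parameter when its coefficients do and are
dominated by a square-summable sequence. -/
lemma continuous_tsum_smul (he : Orthonormal ℂ e) {X : Type*} [TopologicalSpace X]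
    {c : ι → X → ℂ} {b : ι → ℝ} (hcont : ∀ k, Continuous (c k))
    (hb : Summable fun k => b k ^ 2) (hcb : ∀ k x, ‖c k x‖ ≤ b k) :
    Continuous fun x => ∑' k, c k x • e k := by
  have hs : ∀ x, Summable fun k => ‖c k x‖ ^ 2 := fun x =>
    hb.of_nonneg_of_le (fun k => by positivity)
      fun k => pow_le_pow_left₀ (norm_nonneg _) (hcb k x) 2
  rw [continuous_iff_continuousAt]
  intro x₀
  have hle : ∀ k x, ‖c k x - c k x₀‖ ≤ 2 * b k := fun k x => by
    linarith [norm_sub_le (c k x) (c k x₀), hcb k x, hcb k x₀]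
  have hs' : ∀ x, Summable fun k => ‖c k x - c k x₀‖ ^ 2 := fun x =>
    (hb.mul_left 4).of_nonneg_of_le (fun k => by positivity) fun k => by
      calc _ ≤ (2 * b k) ^ 2 := pow_le_pow_left₀ (norm_nonneg _) (hle k x) 2
        _ = _ := by ring
  have h1 : Continuous fun x => ∑' k, ‖c k x - c k x₀‖ ^ 2 := by
    refine continuous_tsum (fun k => by have := hcont k; fun_prop) (hb.mul_left 4) fun k x => ?_
    rw [Real.norm_of_nonneg (by positivity)]
    calc _ ≤ (2 * b k) ^ 2 := pow_le_pow_left₀ (norm_nonneg _) (hle k x) 2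
      _ = _ := by ring
  refine tendsto_iff_norm_sub_tendsto_zero.2 ?_
  have h2 : (fun x => ‖(∑' k, c k x • e k) - ∑' k, c k x₀ • e k‖)
      = fun x => √(∑' k, ‖c k x - c k x₀‖ ^ 2) := by
    funext x
    rw [tsum_smul_sub he (hs x) (hs x₀), ← norm_sq_tsum_smul he (hs' x),
      Real.sqrt_sq (norm_nonneg _)]
  rw [h2]
  have h3 := h1.sqrt.tendsto x₀
  simpa using h3

end Orthonormal

/-! ### Fourier coefficients on the torus -/

section Torus

variable {L₁ L₂ : ℝ}

lemma character_neg (k : ℤ × ℤ) (x : Torus L₁ L₂) :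
    character L₁ L₂ (-k) x = (starRingEnd ℂ) (character L₁ L₂ k x) := by
  simp [character]

lemma norm_character (k : ℤ × ℤ) (x : Torus L₁ L₂) : ‖character L₁ L₂ k x‖ = 1 := by
  simp only [character, ContinuousMap.coe_mk, norm_mul, fourier_apply, Circle.norm_coe, mul_one]

variable [Fact (0 < L₁)] [Fact (0 < L₂)]

lemma orthonormal_characterL2 :
    Orthonormal ℂ (characterL2 : ℤ × ℤ → L2Complex L₁ L₂) := by
  rw [orthonormal_iff_ite]
  intro k l
  have h1 := orthonormal_iff_ite.1 (orthonormal_fourier (T := L₁)) k.1 l.1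
  have h2 := orthonormal_iff_ite.1 (orthonormal_fourier (T := L₂)) k.2 l.2
  simp only [fourierLp, ContinuousMap.inner_toLp] at h1 h2
  rw [characterL2, characterL2, ContinuousMap.inner_toLp]
  have h3 : ∀ x : Torus L₁ L₂,
      character L₁ L₂ l x * (starRingEnd ℂ) (character L₁ L₂ k x)
      = (fourier l.1 x.1 * (starRingEnd ℂ) (fourier k.1 x.1))
        * (fourier l.2 x.2 * (starRingEnd ℂ) (fourier k.2 x.2)) := by
    intro x
    simp only [character, ContinuousMap.coe_mk, map_mul]
    ring
  simp only [h3]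
  rw [integral_prod_mul (fun x => fourier l.1 x * (starRingEnd ℂ) (fourier k.1 x))
    (fun x => fourier l.2 x * (starRingEnd ℂ) (fourier k.2 x)), h1, h2]
  by_cases a : k.1 = l.1 <;> by_cases b : k.2 = l.2 <;> simp [a, b, Prod.ext_iff]

lemma coeff_eq_inner (f : L2Complex L₁ L₂) (k : ℤ × ℤ) :
    coeff f k = inner ℂ (characterL2 k) f := by
  rw [L2.inner_def, coeff]
  refine integral_congr_ae ?_
  filter_upwards [ContinuousMap.coeFn_toLp (p := 2) (𝕜 := ℂ) (torusMeasure L₁ L₂)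
    (character L₁ L₂ k)] with x hx
  rw [characterL2, hx, character_neg, RCLike.inner_apply, mul_comm]

lemma summable_coeff_sq (f : L2Complex L₁ L₂) : Summable fun k => ‖coeff f k‖ ^ 2 := by
  simp only [coeff_eq_inner]
  exact orthonormal_characterL2.inner_products_summable f

lemma tsum_coeff_sq_le (f : L2Complex L₁ L₂) : ∑' k, ‖coeff f k‖ ^ 2 ≤ ‖f‖ ^ 2 := by
  simp only [coeff_eq_inner]
  exact orthonormal_characterL2.tsum_inner_products_le f

lemma coeff_tsum_smul {c : ℤ × ℤ → ℂ} (hc : Summable fun k => ‖c k‖ ^ 2) (k : ℤ × ℤ) :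
    coeff (∑' l, c l • characterL2 l : L2Complex L₁ L₂) k = c k := by
  rw [coeff_eq_inner, inner_tsum_smul orthonormal_characterL2 hc]

lemma coeff_sub (f g : L2Complex L₁ L₂) (k : ℤ × ℤ) :
    coeff (f - g : L2Complex L₁ L₂) k = coeff f k - coeff g k := by
  simp only [coeff_eq_inner, inner_sub_right]

end Torus

/-! ### Bounds on the symbol -/

section Symbol

variable {L₁ L₂ : ℝ}

lemma waveSq_nonneg (k : ℤ × ℤ) : 0 ≤ waveSq L₁ L₂ k := by
  unfold waveSq; positivity

lemma waveVec_sq_le (k : ℤ × ℤ) (j : Fin 2) : waveVec L₁ L₂ k j ^ 2 ≤ waveSq L₁ L₂ k := by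
  unfold waveSq
  fin_cases j <;> simp <;> positivity

lemma abs_waveVec_le (k : ℤ × ℤ) (j : Fin 2) : |waveVec L₁ L₂ k j| ≤ √(waveSq L₁ L₂ k) := by
  rw [← Real.sqrt_sq_eq_abs]
  exact Real.sqrt_le_sqrt (waveVec_sq_le k j)

lemma waveSq_neg (k : ℤ × ℤ) : waveSq L₁ L₂ (-k) = waveSq L₁ L₂ k := by
  simp [waveSq, waveVec, neg_div]

lemma waveVec_neg (k : ℤ × ℤ) (j : Fin 2) : waveVec L₁ L₂ (-k) j = -waveVec L₁ L₂ k j := by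
  fin_cases j <;> simp [waveVec, neg_div]

lemma symbol_neg (k : ℤ × ℤ) : symbol L₁ L₂ (-k) = symbol L₁ L₂ k := by
  simp [symbol, waveSq_neg]

lemma symbol_ge (k : ℤ × ℤ) : waveSq L₁ L₂ k ^ 2 / 2 - 1 / 2 ≤ symbol L₁ L₂ k := by
  unfold symbol
  nlinarith [sq_nonneg (waveSq L₁ L₂ k - 1)]

lemma exp_neg_mul_symbol_le {t : ℝ} (ht : 0 ≤ t) (ht1 : t ≤ 1) (k : ℤ × ℤ) :
    Real.exp (-t * symbol L₁ L₂ k)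
      ≤ Real.exp (1 / 2) * Real.exp (-(t * waveSq L₁ L₂ k ^ 2 / 2)) := by
  rw [← Real.exp_add, Real.exp_le_exp]
  nlinarith [mul_le_mul_of_nonneg_left (symbol_ge (L₁ := L₁) (L₂ := L₂) k) ht]

lemma exp_half_le_two : Real.exp (1 / 2) ≤ 2 := by
  have h : Real.exp (1 / 2) ^ 2 = Real.exp 1 := by
    rw [← Real.exp_nat_mul]; norm_num
  nlinarith [Real.exp_one_lt_d9, Real.exp_pos (1 / 2)]

lemma exp_neg_mul_symbol_le_two {t : ℝ} (ht : 0 ≤ t) (ht1 : t ≤ 1) (k : ℤ × ℤ) :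
    Real.exp (-t * symbol L₁ L₂ k) ≤ 2 := by
  have h1 : -t * symbol L₁ L₂ k ≤ 1 / 2 := by
    nlinarith [mul_le_mul_of_nonneg_left (symbol_ge (L₁ := L₁) (L₂ := L₂) k) ht,
      mul_nonneg ht (sq_nonneg (waveSq L₁ L₂ k))]
  exact (Real.exp_le_exp.2 h1).trans exp_half_le_two

lemma exp_neg_mul_symbol_sq_le {t : ℝ} (ht : 0 ≤ t) (ht1 : t ≤ 1) (k : ℤ × ℤ) :
    Real.exp (-t * symbol L₁ L₂ k) ^ 2
      ≤ Real.exp 1 * Real.exp (-(t * waveSq L₁ L₂ k ^ 2)) := by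
  refine (pow_le_pow_left₀ (Real.exp_pos _).le (exp_neg_mul_symbol_le ht ht1 k) 2).trans_eq ?_
  rw [mul_pow, ← Real.exp_nat_mul, ← Real.exp_nat_mul]
  push_cast
  congr 2 <;> ring

/-- Inverse powers of `|k̃|²` are summable over the lattice beyond the critical exponent `1`;
the term of `k = 0` is `0 ^ (-p) = 0`. -/
lemma summable_waveSq_rpow (hL₁ : 0 < L₁) (hL₂ : 0 < L₂) {p : ℝ} (hp : 1 < p) :
    Summable fun k : ℤ × ℤ => waveSq L₁ L₂ k ^ (-p) := by
  have h := EisensteinSeries.summable_one_div_norm_rpow (k := 2 * p) (by linarith)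
  rw [← (finTwoArrowEquiv ℤ).symm.summable_iff] at h
  set c : ℝ := (2 * Real.pi / max L₁ L₂) ^ 2 with hc
  have hm : 0 < max L₁ L₂ := lt_max_of_lt_left hL₁
  have hcpos : 0 < c := by positivity
  refine (h.mul_left (c ^ (-p))).of_nonneg_of_le
    (fun k => Real.rpow_nonneg (waveSq_nonneg k) _) fun k => ?_
  by_cases hk : k = 0
  · subst hk
    simp only [waveSq, waveVec]
    simp only [Prod.fst_zero, Prod.snd_zero]
    norm_num
    rw [Real.zero_rpow (by linarith)]
    positivity
  set n : ℝ := ‖((finTwoArrowEquiv ℤ).symm k : Fin 2 → ℤ)‖ with hn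
  have hnpos : 0 < n := by
    rw [hn, norm_pos_iff]
    intro h0
    exact hk ((finTwoArrowEquiv ℤ).symm.injective (h0.trans (by ext i; fin_cases i <;> rfl)))
  have key : c * n ^ 2 ≤ waveSq L₁ L₂ k := by
    have hcase : ∀ j : Fin 2, c * (((finTwoArrowEquiv ℤ).symm k j : ℤ) : ℝ) ^ 2
        ≤ waveSq L₁ L₂ k := by
      intro j
      refine le_trans ?_ (waveVec_sq_le k j)
      have haux : ∀ {L : ℝ} (_ : 0 < L) (_ : L ≤ max L₁ L₂) (i : ℤ),
          c * (i : ℝ) ^ 2 ≤ (2 * Real.pi * i / L) ^ 2 := by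
        intro L hL hLm i
        rw [hc, ← mul_pow, div_mul_eq_mul_div, div_pow, div_pow]
        gcongr
      fin_cases j
      · exact haux hL₁ (le_max_left _ _) k.1
      · exact haux hL₂ (le_max_right _ _) k.2
    obtain ⟨j, hj⟩ : ∃ j, n = ‖(finTwoArrowEquiv ℤ).symm k j‖ := by
      obtain ⟨j, -, hj⟩ := Finset.exists_mem_eq_sup' (Finset.univ_nonempty (α := Fin 2))
        (fun j => ‖(finTwoArrowEquiv ℤ).symm k j‖₊)
      refine ⟨j, ?_⟩
      rw [hn, Pi.norm_def, ← Finset.sup'_eq_sup Finset.univ_nonempty, hj]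
      rfl
    rw [hj, Int.norm_eq_abs, sq_abs]
    exact hcase j
  calc waveSq L₁ L₂ k ^ (-p) ≤ (c * n ^ 2) ^ (-p) :=
        Real.rpow_le_rpow_of_nonpos (by positivity) key (by linarith)
    _ = c ^ (-p) * n ^ (-(2 * p)) := by
        rw [Real.mul_rpow hcpos.le (by positivity), ← Real.rpow_natCast n 2, ← Real.rpow_mul hnpos.le]
        congr 2
        push_cast; ring
    _ = _ := rfl

end Symbol

section Smoothing

variable {L₁ L₂ : ℝ}

/-! ### The nonlinearity -/

section Nonlinearity

variable [Fact (0 < L₁)] [Fact (0 < L₂)]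

lemma integrable_halfSq (u : L2Field L₁ L₂) : Integrable (halfSq u) (torusMeasure L₁ L₂) := by
  have h := (Lp.memLp u).integrable_norm_pow (p := 2) (by norm_num)
  exact (h.div_const 2).ofReal

/-- Cauchy–Schwarz for the pointwise norms of two `L²` functions. -/
lemma integral_norm_mul_norm_le {α F : Type*} [MeasurableSpace α] {μ : Measure α}
    [NormedAddCommGroup F] [InnerProductSpace ℝ F] (u v : Lp F 2 μ) :
    ∫ x, ‖u x‖ * ‖v x‖ ∂μ ≤ ‖u‖ * ‖v‖ := by
  have h := integral_mul_norm_le_Lp_mul_Lq (μ := μ) (f := u) (g := v)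
    Real.HolderConjugate.two_two (by simpa using Lp.memLp u) (by simpa using Lp.memLp v)
  have hn : ∀ w : Lp F 2 μ, (∫ x, ‖w x‖ ^ (2 : ℝ) ∂μ) ^ (1 / (2 : ℝ)) = ‖w‖ := by
    intro w
    have := real_inner_self_eq_norm_sq w
    rw [L2.inner_def] at this
    simp only [real_inner_self_eq_norm_sq] at this
    simp only [Real.rpow_two]
    rw [this, ← Real.sqrt_eq_rpow, Real.sqrt_sq (norm_nonneg _)]
  rwa [hn, hn] at h

lemma norm_coeff_halfSq_sub_le (u v : L2Field L₁ L₂) (k : ℤ × ℤ) :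
    ‖coeff (halfSq u) k - coeff (halfSq v) k‖ ≤ ‖u - v‖ * ‖u + v‖ / 2 := by
  have hint : ∀ w : L2Field L₁ L₂, Integrable
      (fun x => character L₁ L₂ (-k) x * halfSq w x) (torusMeasure L₁ L₂) := fun w =>
    (integrable_halfSq w).bdd_mul (c := 1)
      (character L₁ L₂ (-k)).continuous.aestronglyMeasurable
      (Filter.Eventually.of_forall fun x => (norm_character _ _).le)
  rw [coeff, coeff, ← integral_sub (hint u) (hint v)]
  have hle : ∀ᵐ x ∂(torusMeasure L₁ L₂),
      ‖character L₁ L₂ (-k) x * halfSq u x - character L₁ L₂ (-k) x * halfSq v x‖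
        ≤ ‖(u - v : L2Field L₁ L₂) x‖ * ‖(u + v : L2Field L₁ L₂) x‖ / 2 := by
    filter_upwards [Lp.coeFn_sub u v, Lp.coeFn_add u v] with x h1 h2
    rw [← mul_sub, norm_mul, norm_character, one_mul, h1, h2]
    simp only [halfSq, Pi.sub_apply, Pi.add_apply]
    rw [← Complex.ofReal_sub, Complex.norm_real, ← sub_div, norm_div, Real.norm_two]
    gcongr
    have : ‖u x‖ ^ 2 - ‖v x‖ ^ 2 = inner ℝ (u x - v x) (u x + v x) := by
      rw [inner_sub_left, inner_add_right, inner_add_right, real_inner_comm (u x) (v x),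
        real_inner_self_eq_norm_sq, real_inner_self_eq_norm_sq]
      ring
    rw [this]
    exact norm_inner_le_norm _ _
  have hI : Integrable (fun x => ‖(u - v : L2Field L₁ L₂) x‖ * ‖(u + v : L2Field L₁ L₂) x‖ / 2)
      (torusMeasure L₁ L₂) :=
    ((Lp.memLp (u - v)).norm.integrable_mul (Lp.memLp (u + v)).norm).div_const 2
  refine (norm_integral_le_of_norm_le hI hle).trans ?_
  rw [integral_div]
  gcongr
  exact integral_norm_mul_norm_le _ _

lemma norm_coeff_halfSq_le (u : L2Field L₁ L₂) (k : ℤ × ℤ) :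
    ‖coeff (halfSq u) k‖ ≤ ‖u‖ ^ 2 / 2 := by
  have h0 : coeff (halfSq (0 : L2Field L₁ L₂)) k = 0 := by
    rw [coeff]
    refine integral_eq_zero_of_ae ?_
    filter_upwards [Lp.coeFn_zero (EuclideanSpace ℝ (Fin 2)) 2 (torusMeasure L₁ L₂)] with x hx
    simp only [halfSq, hx, Pi.zero_apply, norm_zero]
    norm_num
  have h := norm_coeff_halfSq_sub_le u 0 k
  rw [h0, sub_zero, sub_zero, add_zero] at h
  rwa [sq]

lemma continuous_coeff_halfSq (k : ℤ × ℤ) :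
    Continuous fun u : L2Field L₁ L₂ => coeff (halfSq u) k := by
  rw [continuous_iff_continuousAt]
  intro u₀
  refine tendsto_iff_norm_sub_tendsto_zero.2 ?_
  have h : Filter.Tendsto (fun u : L2Field L₁ L₂ => ‖u - u₀‖ * ‖u + u₀‖ / 2) (nhds u₀)
      (nhds (‖u₀ - u₀‖ * ‖u₀ + u₀‖ / 2)) :=
    Continuous.tendsto (by fun_prop) u₀
  rw [sub_self, norm_zero, zero_mul, zero_div] at h
  exact squeeze_zero (fun _ => norm_nonneg _) (fun u => norm_coeff_halfSq_sub_le u u₀ k) h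

end Nonlinearity

/-! ### Smoothing by the semigroup -/

lemma rpow_mul_exp_neg_le_two {x : ℝ} (hx : 0 ≤ x) :
    x ^ (3 / 2 : ℝ) * Real.exp (-x) ≤ 2 := by
  rw [Real.exp_neg, ← div_eq_mul_inv, div_le_iff₀ (Real.exp_pos _)]
  have h1 : x ^ (3 / 2 : ℝ) = x * √x := by
    rw [Real.sqrt_eq_rpow, show (3 / 2 : ℝ) = 1 + 1 / 2 by norm_num,
      Real.rpow_add_of_nonneg hx (by norm_num) (by norm_num), Real.rpow_one]
  have h2 : √x ≤ (1 + x) / 2 := by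
    nlinarith [Real.sq_sqrt hx, sq_nonneg (√x - 1)]
  rw [h1]
  nlinarith [Real.quadratic_le_exp_of_nonneg hx, mul_le_mul_of_nonneg_left h2 hx]

/-- The symbol of `e^{-tℒ} ∂_j`. -/
def derivSymbol (L₁ L₂ t : ℝ) (j : Fin 2) (k : ℤ × ℤ) : ℂ :=
  (Real.exp (-t * symbol L₁ L₂ k) : ℂ) * (Complex.I * (waveVec L₁ L₂ k j : ℂ))

lemma norm_derivSymbol (t : ℝ) (j : Fin 2) (k : ℤ × ℤ) :
    ‖derivSymbol L₁ L₂ t j k‖ = Real.exp (-t * symbol L₁ L₂ k) * |waveVec L₁ L₂ k j| := by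
  rw [derivSymbol, norm_mul, norm_mul, Complex.norm_I, one_mul, Complex.norm_real,
    Complex.norm_real, Real.norm_of_nonneg (Real.exp_pos _).le, Real.norm_eq_abs]

/-- The exponent `-3/2` is one choice among many: the power of `|k̃|²` has to be summable over the
lattice, and the square root of the power of `t` integrable at `0`. -/
lemma norm_derivSymbol_sq_le {t : ℝ} (ht : 0 < t) (ht1 : t ≤ 1) (j : Fin 2) (k : ℤ × ℤ) :
    ‖derivSymbol L₁ L₂ t j k‖ ^ 2
      ≤ 2 * Real.exp 1 * t ^ (-(3 / 2) : ℝ) * waveSq L₁ L₂ k ^ (-2 : ℝ) := by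
  set q := waveSq L₁ L₂ k with hq
  have hq0 : 0 ≤ q := waveSq_nonneg k
  have h1 : ‖derivSymbol L₁ L₂ t j k‖ ^ 2 ≤ Real.exp 1 * Real.exp (-(t * q ^ 2)) * q := by
    rw [norm_derivSymbol, mul_pow, sq_abs]
    exact mul_le_mul (exp_neg_mul_symbol_sq_le ht.le ht1 k) (waveVec_sq_le k j) (sq_nonneg _)
      (by positivity)
  refine h1.trans ?_
  rcases hq0.eq_or_lt with h0 | hpos
  · rw [← h0, mul_zero, Real.zero_rpow (by norm_num), mul_zero]
  have h2 := rpow_mul_exp_neg_le_two (x := t * q ^ 2) (by positivity)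
  have h3 : (t * q ^ 2) ^ (3 / 2 : ℝ) = t ^ (3 / 2 : ℝ) * q ^ 3 := by
    rw [Real.mul_rpow ht.le (by positivity), ← Real.rpow_natCast q 2, ← Real.rpow_mul hpos.le,
      ← Real.rpow_natCast q 3]
    norm_num
  rw [h3] at h2
  rw [Real.rpow_neg ht.le, Real.rpow_neg hpos.le, Real.rpow_two]
  have h4 : 0 < t ^ (3 / 2 : ℝ) := by positivity
  rw [← div_eq_mul_inv, ← div_eq_mul_inv, div_div, le_div_iff₀ (by positivity)]
  calc _ = Real.exp 1 * (t ^ (3 / 2 : ℝ) * q ^ 3 * Real.exp (-(t * q ^ 2))) := by ring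
    _ ≤ Real.exp 1 * 2 := by gcongr
    _ = _ := by ring

/-- The constant in the smoothing estimate `‖e^{-tℒ} ∂_j f‖ ≤ K t^{-3/4} sup |f̂|`. -/
def smoothingConst (L₁ L₂ : ℝ) : ℝ :=
  √(2 * Real.exp 1 * ∑' k : ℤ × ℤ, waveSq L₁ L₂ k ^ (-2 : ℝ))

lemma smoothingConst_nonneg : 0 ≤ smoothingConst L₁ L₂ := Real.sqrt_nonneg _

lemma norm_derivSymbol_mul_sq_le {t : ℝ} (ht : 0 < t) (ht1 : t ≤ 1) (j : Fin 2)
    {c : ℤ × ℤ → ℂ} {A : ℝ} (hc : ∀ k, ‖c k‖ ≤ A) (k : ℤ × ℤ) :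
    ‖derivSymbol L₁ L₂ t j k * c k‖ ^ 2
      ≤ (2 * Real.exp 1 * t ^ (-(3 / 2) : ℝ) * A ^ 2) * waveSq L₁ L₂ k ^ (-2 : ℝ) := by
  rw [norm_mul, mul_pow]
  calc _ ≤ (2 * Real.exp 1 * t ^ (-(3 / 2) : ℝ) * waveSq L₁ L₂ k ^ (-2 : ℝ)) * A ^ 2 :=
        mul_le_mul (norm_derivSymbol_sq_le ht ht1 j k)
          (pow_le_pow_left₀ (norm_nonneg _) (hc k) 2) (by positivity)
          ((sq_nonneg _).trans (norm_derivSymbol_sq_le ht ht1 j k))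
    _ = _ := by ring

variable [Fact (0 < L₁)] [Fact (0 < L₂)]

lemma summable_derivSymbol_mul {t : ℝ} (ht : 0 < t) (ht1 : t ≤ 1) (j : Fin 2) {c : ℤ × ℤ → ℂ}
    {A : ℝ} (hc : ∀ k, ‖c k‖ ≤ A) :
    Summable fun k => ‖derivSymbol L₁ L₂ t j k * c k‖ ^ 2 :=
  ((summable_waveSq_rpow (Fact.out : 0 < L₁) (Fact.out : 0 < L₂) (p := 2)
    (by norm_num)).mul_left _).of_nonneg_of_le
    (fun k => by positivity) (norm_derivSymbol_mul_sq_le ht ht1 j hc)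

/-- Only the supremum of the Fourier coefficients enters, so that the estimate applies to the
merely integrable function `|u|²/2`. -/
lemma norm_tsum_derivSymbol_le {t : ℝ} (ht : 0 < t) (ht1 : t ≤ 1) (j : Fin 2) {c : ℤ × ℤ → ℂ}
    {A : ℝ} (hc : ∀ k, ‖c k‖ ≤ A) :
    ‖(∑' k, (derivSymbol L₁ L₂ t j k * c k) • characterL2 k : L2Complex L₁ L₂)‖
      ≤ smoothingConst L₁ L₂ * t ^ (-(3 / 4) : ℝ) * A := by
  have hA : 0 ≤ A := (norm_nonneg _).trans (hc 0)
  have hs := summable_derivSymbol_mul (L₁ := L₁) (L₂ := L₂) ht ht1 j hc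
  have hq := summable_waveSq_rpow (Fact.out : 0 < L₁) (Fact.out : 0 < L₂) (p := 2) (by norm_num)
  refine abs_le_of_sq_le_sq' ?_ (by
    have := smoothingConst_nonneg (L₁ := L₁) (L₂ := L₂); positivity) |>.2
  rw [norm_sq_tsum_smul orthonormal_characterL2 hs, mul_pow, mul_pow, smoothingConst, Real.sq_sqrt
    (mul_nonneg (by positivity) (tsum_nonneg fun k => Real.rpow_nonneg (waveSq_nonneg k) _)),
    ← Real.rpow_natCast (t ^ (-(3 / 4) : ℝ)) 2, ← Real.rpow_mul ht.le]
  refine (hs.tsum_le_tsum (norm_derivSymbol_mul_sq_le ht ht1 j hc) (hq.mul_left _)).trans_eq ?_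
  rw [tsum_mul_left, show (-(3 / 4) : ℝ) * ((2 : ℕ) : ℝ) = -(3 / 2) by norm_num]
  ring

lemma norm_semigroupDeriv_sub_le {t : ℝ} (ht : 0 < t) (ht1 : t ≤ 1) (j : Fin 2)
    (u v : L2Field L₁ L₂) :
    ‖(semigroupDeriv t j (halfSq u) : L2Complex L₁ L₂) - semigroupDeriv t j (halfSq v)‖
      ≤ smoothingConst L₁ L₂ * t ^ (-(3 / 4) : ℝ) * (‖u - v‖ * ‖u + v‖ / 2) := by
  have h := tsum_smul_sub (orthonormal_characterL2 (L₁ := L₁) (L₂ := L₂))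
    (summable_derivSymbol_mul (L₁ := L₁) (L₂ := L₂) ht ht1 j (norm_coeff_halfSq_le u))
    (summable_derivSymbol_mul (L₁ := L₁) (L₂ := L₂) ht ht1 j (norm_coeff_halfSq_le v))
  simp only [← mul_sub] at h
  exact (congrArg norm h).trans_le
    (norm_tsum_derivSymbol_le ht ht1 j (norm_coeff_halfSq_sub_le u v))

lemma norm_semigroupDeriv_le {t : ℝ} (ht : 0 < t) (ht1 : t ≤ 1) (j : Fin 2)
    (u : L2Field L₁ L₂) :
    ‖(semigroupDeriv t j (halfSq u) : L2Complex L₁ L₂)‖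
      ≤ smoothingConst L₁ L₂ * t ^ (-(3 / 4) : ℝ) * (‖u‖ ^ 2 / 2) :=
  norm_tsum_derivSymbol_le ht ht1 j (norm_coeff_halfSq_le u)

lemma norm_exp_mul_coeff_sq_le {t : ℝ} (ht : 0 ≤ t) (ht1 : t ≤ 1) (f : L2Complex L₁ L₂)
    (k : ℤ × ℤ) :
    ‖(Real.exp (-t * symbol L₁ L₂ k) : ℂ) * coeff f k‖ ^ 2 ≤ 4 * ‖coeff f k‖ ^ 2 := by
  rw [norm_mul, mul_pow, Complex.norm_real, Real.norm_of_nonneg (Real.exp_pos _).le]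
  gcongr
  nlinarith [Real.exp_pos (-t * symbol L₁ L₂ k),
    exp_neg_mul_symbol_le_two (L₁ := L₁) (L₂ := L₂) ht ht1 k]

lemma summable_semigroup {t : ℝ} (ht : 0 ≤ t) (ht1 : t ≤ 1) (f : L2Complex L₁ L₂) :
    Summable fun k => ‖(Real.exp (-t * symbol L₁ L₂ k) : ℂ) * coeff f k‖ ^ 2 :=
  ((summable_coeff_sq f).mul_left 4).of_nonneg_of_le (fun k => by positivity)
    (norm_exp_mul_coeff_sq_le ht ht1 f)

lemma norm_semigroup_le {t : ℝ} (ht : 0 ≤ t) (ht1 : t ≤ 1) (f : L2Complex L₁ L₂) :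
    ‖semigroup t f‖ ≤ 2 * ‖f‖ := by
  refine abs_le_of_sq_le_sq' ?_ (by positivity) |>.2
  rw [semigroup, multiplier,
    norm_sq_tsum_smul orthonormal_characterL2 (summable_semigroup ht ht1 f)]
  refine ((summable_semigroup ht ht1 f).tsum_le_tsum (norm_exp_mul_coeff_sq_le ht ht1 f)
    ((summable_coeff_sq f).mul_left 4)).trans ?_
  rw [tsum_mul_left]
  nlinarith [tsum_coeff_sq_le f]

lemma coeff_semigroup {t : ℝ} (ht : 0 ≤ t) (ht1 : t ≤ 1) (f : L2Complex L₁ L₂) (k : ℤ × ℤ) :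
    coeff (semigroup t f : L2Complex L₁ L₂) k
      = (Real.exp (-t * symbol L₁ L₂ k) : ℂ) * coeff f k :=
  coeff_tsum_smul (summable_semigroup ht ht1 f) k

lemma continuousOn_semigroup (f : L2Complex L₁ L₂) :
    ContinuousOn (fun t => semigroup t f : ℝ → L2Complex L₁ L₂) (Set.Icc 0 1) := by
  rw [continuousOn_iff_continuous_domRestrict]
  refine continuous_tsum_smul orthonormal_characterL2
    (b := fun k => 2 * ‖coeff f k‖)
    (c := fun k (t : Set.Icc (0 : ℝ) 1) =>
      (Real.exp (-t * symbol L₁ L₂ k) : ℂ) * coeff f k) (fun k => by fun_prop) ?_ ?_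
  · simpa only [mul_pow] using (summable_coeff_sq f).mul_left ((2 : ℝ) ^ 2)
  · intro k t
    rw [norm_mul, Complex.norm_real, Real.norm_of_nonneg (Real.exp_pos _).le]
    gcongr
    exact exp_neg_mul_symbol_le_two t.2.1 t.2.2 k

end Smoothing

section RealFields

variable {L₁ L₂ : ℝ} [Fact (0 < L₁)] [Fact (0 < L₂)]

/-! ### Real-valued fields and their complex components -/

/-- Complex conjugation on `L²(𝕋²; ℂ)`, as a real-linear map. Its fixed points are the real-valued
functions. -/
def conjL2 : L2Complex L₁ L₂ →L[ℝ] L2Complex L₁ L₂ :=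
  (Complex.conjCLE : ℂ →L[ℝ] ℂ).compLpL 2 (torusMeasure L₁ L₂)

lemma coeFn_conjL2 (f : L2Complex L₁ L₂) :
    ∀ᵐ x ∂(torusMeasure L₁ L₂), conjL2 f x = (starRingEnd ℂ) (f x) :=
  (Complex.conjCLE : ℂ →L[ℝ] ℂ).coeFn_compLp f

lemma conjL2_smul_characterL2 (c : ℂ) (k : ℤ × ℤ) :
    conjL2 (c • characterL2 k : L2Complex L₁ L₂) = (starRingEnd ℂ) c • characterL2 (-k) := by
  refine Lp.ext ?_
  have h : ∀ l, ∀ᵐ x ∂(torusMeasure L₁ L₂),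
      (characterL2 l : L2Complex L₁ L₂) x = character L₁ L₂ l x := fun l =>
    ContinuousMap.coeFn_toLp (p := 2) (𝕜 := ℂ) (torusMeasure L₁ L₂) (character L₁ L₂ l)
  filter_upwards [coeFn_conjL2 (c • characterL2 k : L2Complex L₁ L₂), h k, h (-k),
    Lp.coeFn_smul c (characterL2 k : L2Complex L₁ L₂),
    Lp.coeFn_smul ((starRingEnd ℂ) c) (characterL2 (-k) : L2Complex L₁ L₂)] with x h1 h2 h3 h4 h5
  rw [h1, h4, h5, Pi.smul_apply, Pi.smul_apply, h2, h3, character_neg, smul_eq_mul, map_mul,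
    smul_eq_mul]

/-- A Fourier series with Hermitian coefficients is real-valued. -/
lemma conjL2_tsum_smul {c : ℤ × ℤ → ℂ} (hc : Summable fun k => ‖c k‖ ^ 2)
    (hneg : ∀ k, c (-k) = (starRingEnd ℂ) (c k)) :
    conjL2 (∑' k, c k • characterL2 k : L2Complex L₁ L₂) = ∑' k, c k • characterL2 k := by
  rw [conjL2.map_tsum (summable_smul_of_orthonormal orthonormal_characterL2 hc)]
  simp only [conjL2_smul_characterL2, ← hneg]
  exact (Equiv.neg (ℤ × ℤ)).tsum_eq (fun k => c k • (characterL2 k : L2Complex L₁ L₂))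

lemma coeff_neg_of_real {f : Torus L₁ L₂ → ℂ}
    (hf : ∀ᵐ x ∂(torusMeasure L₁ L₂), (starRingEnd ℂ) (f x) = f x) (k : ℤ × ℤ) :
    coeff f (-k) = (starRingEnd ℂ) (coeff f k) := by
  rw [coeff, coeff, ← integral_conj]
  refine integral_congr_ae ?_
  filter_upwards [hf] with x hx
  rw [map_mul, hx, character_neg]

lemma coeFn_component (j : Fin 2) (w : L2Field L₁ L₂) :
    ∀ᵐ x ∂(torusMeasure L₁ L₂), component j w x = ((w x j : ℝ) : ℂ) :=
  (Complex.ofRealCLM.comp (EuclideanSpace.proj (𝕜 := ℝ) j)).coeFn_compLp w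

lemma conjL2_semigroup_component {t : ℝ} (ht : 0 ≤ t) (ht1 : t ≤ 1) (j : Fin 2)
    (w : L2Field L₁ L₂) :
    conjL2 (semigroup t (component j w)) = semigroup t (component j w) := by
  refine conjL2_tsum_smul (summable_semigroup ht ht1 _) fun k => ?_
  have hr : ∀ᵐ x ∂(torusMeasure L₁ L₂), (starRingEnd ℂ) (component j w x) = component j w x := by
    filter_upwards [coeFn_component j w] with x hx
    rw [hx, Complex.conj_ofReal]
  beta_reduce
  rw [symbol_neg, coeff_neg_of_real hr, map_mul, Complex.conj_ofReal]

lemma conjL2_semigroupDeriv {t : ℝ} (ht : 0 < t) (ht1 : t ≤ 1) (j : Fin 2) (w : L2Field L₁ L₂) :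
    conjL2 (semigroupDeriv t j (halfSq w)) = semigroupDeriv t j (halfSq w) := by
  refine conjL2_tsum_smul (summable_derivSymbol_mul ht ht1 j (norm_coeff_halfSq_le w)) fun k => ?_
  have hr : ∀ᵐ x ∂(torusMeasure L₁ L₂), (starRingEnd ℂ) (halfSq w x) = halfSq w x :=
    Filter.Eventually.of_forall fun x => Complex.conj_ofReal _
  beta_reduce
  rw [symbol_neg, waveVec_neg, coeff_neg_of_real hr]
  simp only [map_mul, Complex.conj_ofReal, Complex.conj_I, Complex.ofReal_neg]
  ring

/-- The real part of a complex number, placed in the `j`-th coordinate. -/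
def singleRe (j : Fin 2) : ℂ →L[ℝ] EuclideanSpace ℝ (Fin 2) :=
  Complex.reCLM.smulRight (EuclideanSpace.single j 1)

lemma norm_singleRe_le (j : Fin 2) : ‖singleRe j‖ ≤ 1 := by
  rw [singleRe, ContinuousLinearMap.norm_smulRight_apply, Complex.reCLM_norm]
  simp

/-- The real vector field whose components are the real parts of two complex functions. -/
def toField (a : Fin 2 → L2Complex L₁ L₂) : L2Field L₁ L₂ :=
  ∑ j, (singleRe j).compLpL 2 (torusMeasure L₁ L₂) (a j)

lemma toField_sub (a b : Fin 2 → L2Complex L₁ L₂) :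
    toField a - toField b = toField (a - b) := by
  simp [toField, Finset.sum_sub_distrib]

lemma norm_toField_le (a : Fin 2 → L2Complex L₁ L₂) : ‖toField a‖ ≤ ∑ j, ‖a j‖ := by
  refine norm_sum_le_of_le _ fun j _ => ?_
  refine ((singleRe j).norm_compLp_le (a j)).trans ?_
  exact mul_le_of_le_one_left (norm_nonneg _) (norm_singleRe_le j)

lemma continuous_toField : Continuous (toField : (Fin 2 → L2Complex L₁ L₂) → L2Field L₁ L₂) := by
  unfold toField; fun_prop

lemma coeFn_toField (a : Fin 2 → L2Complex L₁ L₂) (j : Fin 2) :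
    ∀ᵐ x ∂(torusMeasure L₁ L₂), toField a x j = (a j x).re := by
  have h := fun i => (singleRe i).coeFn_compLp (p := 2) (μ := torusMeasure L₁ L₂) (a i)
  rw [toField, Fin.sum_univ_two]
  filter_upwards [Lp.coeFn_add ((singleRe 0).compLpL 2 (torusMeasure L₁ L₂) (a 0))
    ((singleRe 1).compLpL 2 (torusMeasure L₁ L₂) (a 1)), h 0, h 1] with x h1 h2 h3
  rw [h1, Pi.add_apply]
  change ((singleRe 0).compLp (a 0) x + (singleRe 1).compLp (a 1) x) j = _
  rw [h2, h3]
  fin_cases j <;> simp [singleRe]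

lemma component_toField {a : Fin 2 → L2Complex L₁ L₂} {j : Fin 2} (ha : conjL2 (a j) = a j) :
    component j (toField a) = a j := by
  refine Lp.ext ?_
  have h := coeFn_conjL2 (a j)
  rw [ha] at h
  filter_upwards [coeFn_component j (toField a), coeFn_toField a j, h] with x h1 h2 h3
  rw [h1, h2]
  exact Complex.conj_eq_iff_re.1 h3.symm

lemma toField_component (w : L2Field L₁ L₂) : toField (fun j => component j w) = w := by
  refine Lp.ext ?_
  filter_upwards [coeFn_component 0 w, coeFn_component 1 w,
    coeFn_toField (fun j => component j w) 0, coeFn_toField (fun j => component j w) 1]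
    with x h0 h1 h2 h3
  ext j
  fin_cases j
  · exact h2.trans (by rw [h0, Complex.ofReal_re]; rfl)
  · exact h3.trans (by rw [h1, Complex.ofReal_re]; rfl)

lemma norm_component_le (j : Fin 2) (w : L2Field L₁ L₂) : ‖component j w‖ ≤ ‖w‖ := by
  refine Lp.norm_le_norm_of_ae_le ?_
  filter_upwards [coeFn_component j w] with x hx
  rw [hx, Complex.norm_real]
  exact PiLp.norm_apply_le (w x) j

lemma norm_sub_le_sum_component (v w : L2Field L₁ L₂) :
    ‖v - w‖ ≤ ∑ j, ‖component j v - component j w‖ := by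
  conv_lhs => rw [← toField_component v, ← toField_component w, toField_sub]
  exact norm_toField_le _

end RealFields

section Duhamel

variable {L₁ L₂ : ℝ}

/-! ### The Duhamel integral -/

lemma intervalIntegrable_sub_rpow (t : ℝ) :
    IntervalIntegrable (fun τ : ℝ => (t - τ) ^ (-(3 / 4) : ℝ)) volume 0 t := by
  have h := (intervalIntegral.intervalIntegrable_rpow' (a := t) (b := 0) (r := -(3 / 4))
    (by norm_num)).comp_sub_left t
  simpa using h

lemma integral_sub_rpow (t : ℝ) :
    ∫ τ in (0 : ℝ)..t, (t - τ) ^ (-(3 / 4) : ℝ) = 4 * t ^ (1 / 4 : ℝ) := by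
  rw [intervalIntegral.integral_comp_sub_left (fun r : ℝ => r ^ (-(3 / 4) : ℝ)) t,
    integral_rpow (Or.inl (by norm_num)), sub_self, sub_zero,
    show (-(3 / 4) : ℝ) + 1 = 1 / 4 by norm_num, Real.zero_rpow (by norm_num)]
  ring

/-- The kernel `r ↦ r^{-3/4}` has a Laplace transform that tends to `0`. -/
lemma integral_sub_rpow_mul_exp_le {t lam : ℝ} (ht : 0 ≤ t) (hlam : 0 < lam) :
    ∫ τ in (0 : ℝ)..t, (t - τ) ^ (-(3 / 4) : ℝ) * Real.exp (lam * τ)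
      ≤ Real.exp (lam * t) * ((1 / lam) ^ (1 / 4 : ℝ) * Real.Gamma (1 / 4)) := by
  have h0 : ∀ τ, (t - τ) ^ (-(3 / 4) : ℝ) * Real.exp (lam * τ)
      = Real.exp (lam * t) * ((t - τ) ^ (-(3 / 4) : ℝ) * Real.exp (-(lam * (t - τ)))) := by
    intro τ
    rw [mul_left_comm, ← Real.exp_add]
    congr 2
    ring
  simp only [h0]
  rw [intervalIntegral.integral_const_mul, intervalIntegral.integral_comp_sub_left
    (fun r : ℝ => r ^ (-(3 / 4) : ℝ) * Real.exp (-(lam * r))) t, sub_self, sub_zero,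
    intervalIntegral.integral_of_le ht]
  gcongr
  have hG := Real.integral_rpow_mul_exp_neg_mul_Ioi (a := 1 / 4) (r := lam) (by norm_num) hlam
  rw [show (1 / 4 : ℝ) - 1 = -(3 / 4) by norm_num] at hG
  rw [← hG]
  have hI : IntegrableOn (fun r : ℝ => r ^ (-(3 / 4) : ℝ) * Real.exp (-(lam * r)))
      (Set.Ioi 0) := by
    have := integrableOn_rpow_mul_exp_neg_mul_rpow (p := 1) (s := -(3 / 4)) (b := lam)
      (by norm_num) one_pos hlam
    simpa using this
  refine setIntegral_mono_set hI ?_ (Filter.Eventually.of_forall fun r hr => hr.1)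
  filter_upwards [ae_restrict_mem measurableSet_Ioi] with r hr
  have : (0 : ℝ) < r := hr
  simp only [Pi.zero_apply]
  positivity

lemma continuous_derivSymbol (j : Fin 2) (k : ℤ × ℤ) :
    Continuous fun t => derivSymbol L₁ L₂ t j k := by
  unfold derivSymbol; fun_prop

/-- Uniformly in `t ≤ 1`, integration in time gains the factor `|k̃|⁻⁴` over the symbol of `∂_j`. -/
lemma norm_integral_derivSymbol_mul_le {t : ℝ} (ht : 0 ≤ t) (ht1 : t ≤ 1) (j : Fin 2) (k : ℤ × ℤ)
    {c : ℝ → ℂ} {A : ℝ} (hA : 0 ≤ A) (hc : ∀ τ ∈ Set.Icc 0 t, ‖c τ‖ ≤ A) :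
    ‖∫ τ in (0 : ℝ)..t, derivSymbol L₁ L₂ (t - τ) j k * c τ‖
      ≤ 4 * A * waveSq L₁ L₂ k ^ (-(3 / 2) : ℝ) := by
  set q := waveSq L₁ L₂ k with hq
  have hq0 : 0 ≤ q := waveSq_nonneg k
  have hbound : ∀ τ ∈ Set.Icc 0 t, ‖derivSymbol L₁ L₂ (t - τ) j k * c τ‖
      ≤ 2 * √q * A * Real.exp (-((t - τ) * q ^ 2 / 2)) := by
    intro τ hτ
    have he := exp_half_le_two
    rw [norm_mul, norm_derivSymbol]
    calc _ ≤ 2 * Real.exp (-((t - τ) * q ^ 2 / 2)) * √q * A := by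
          refine mul_le_mul (mul_le_mul ?_ (abs_waveVec_le k j) (abs_nonneg _) (by positivity))
            (hc τ hτ) (norm_nonneg _) (by positivity)
          refine (exp_neg_mul_symbol_le (by linarith [hτ.2]) (by linarith [hτ.1]) k).trans ?_
          gcongr
      _ = _ := by ring
  rcases hq0.eq_or_lt with h0 | hpos
  · rw [← h0, Real.zero_rpow (by norm_num), mul_zero]
    have : (∫ τ in (0 : ℝ)..t, derivSymbol L₁ L₂ (t - τ) j k * c τ) = ∫ τ in (0 : ℝ)..t, 0 := by
      refine intervalIntegral.integral_congr fun τ hτ => ?_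
      rw [Set.uIcc_of_le ht] at hτ
      have h1 := hbound τ hτ
      rw [← h0, Real.sqrt_zero, mul_zero, zero_mul, zero_mul] at h1
      exact norm_le_zero_iff.1 h1
    rw [this]
    simp
  have hderiv : ∀ τ ∈ Set.uIcc 0 t, HasDerivAt
      (fun τ => 2 * √q * A * (2 / q ^ 2) * Real.exp (-((t - τ) * q ^ 2 / 2)))
      (2 * √q * A * Real.exp (-((t - τ) * q ^ 2 / 2))) τ := by
    intro τ _
    have h1 : HasDerivAt (fun τ : ℝ => -((t - τ) * q ^ 2 / 2)) (q ^ 2 / 2) τ := by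
      refine ((((hasDerivAt_id τ).const_sub t).mul_const (q ^ 2)).div_const 2).neg.congr_deriv ?_
      ring
    refine (h1.exp.const_mul (2 * √q * A * (2 / q ^ 2))).congr_deriv ?_
    have hq2 : 2 / q ^ 2 * (q ^ 2 / 2) = 1 := by field_simp
    linear_combination 2 * √q * A * Real.exp (-((t - τ) * q ^ 2 / 2)) * hq2
  have hint : IntervalIntegrable (fun τ => 2 * √q * A * Real.exp (-((t - τ) * q ^ 2 / 2)))
      volume 0 t := Continuous.intervalIntegrable (by fun_prop) _ _
  refine (intervalIntegral.norm_integral_le_of_norm_le ht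
    (Filter.Eventually.of_forall fun τ hτ => hbound τ ⟨hτ.1.le, hτ.2⟩) hint).trans ?_
  rw [intervalIntegral.integral_eq_sub_of_hasDerivAt hderiv hint]
  have h5 : q ^ (-(3 / 2) : ℝ) = √q / q ^ 2 := by
    rw [Real.sqrt_eq_rpow, ← Real.rpow_natCast q 2, ← Real.rpow_sub hpos]
    norm_num
  rw [h5]
  have h6 : 0 ≤ 2 * √q * A * (2 / q ^ 2) * Real.exp (-((t - 0) * q ^ 2 / 2)) := by positivity
  have h7 : 2 * √q * A * (2 / q ^ 2) * Real.exp (-((t - t) * q ^ 2 / 2))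
      = 4 * A * (√q / q ^ 2) := by
    simp only [sub_self, zero_mul, zero_div, neg_zero, Real.exp_zero]
    ring
  linarith

lemma summable_sq_const_mul_waveSq_rpow (hL₁ : 0 < L₁) (hL₂ : 0 < L₂) (A : ℝ) :
    Summable fun k : ℤ × ℤ => (A * waveSq L₁ L₂ k ^ (-(3 / 2) : ℝ)) ^ 2 := by
  refine ((summable_waveSq_rpow hL₁ hL₂ (p := 3) (by norm_num)).mul_left (A ^ 2)).congr fun k => ?_
  rw [mul_pow, ← Real.rpow_natCast (waveSq L₁ L₂ k ^ (-(3 / 2) : ℝ)) 2,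
    ← Real.rpow_mul (waveSq_nonneg k)]
  norm_num

lemma continuous_integral_derivSymbol_mul (j : Fin 2) (k : ℤ × ℤ) {c : ℝ → ℂ}
    (hc : Continuous c) :
    Continuous fun t => ∫ τ in (0 : ℝ)..t, derivSymbol L₁ L₂ (t - τ) j k * c τ := by
  -- The kernel factors through the group law of the exponential, which leaves a primitive.
  have h : ∀ t τ, derivSymbol L₁ L₂ (t - τ) j k * c τ
      = derivSymbol L₁ L₂ t j k * ((Real.exp (τ * symbol L₁ L₂ k) : ℂ) * c τ) := by
    intro t τ
    rw [derivSymbol, derivSymbol, show -(t - τ) * symbol L₁ L₂ k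
      = -t * symbol L₁ L₂ k + τ * symbol L₁ L₂ k by ring, Real.exp_add, Complex.ofReal_mul]
    ring
  simp only [h, intervalIntegral.integral_const_mul]
  refine (continuous_derivSymbol j k).mul (intervalIntegral.continuous_primitive (fun a b => ?_) 0)
  exact Continuous.intervalIntegrable (by fun_prop) _ _

variable [Fact (0 < L₁)] [Fact (0 < L₂)]

lemma intervalIntegrable_semigroupDeriv {u : ℝ → L2Field L₁ L₂} {t : ℝ} (ht : 0 ≤ t) (ht1 : t ≤ 1)
    (hu : ContinuousOn u (Set.Icc 0 t)) (j : Fin 2) :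
    IntervalIntegrable (fun τ : ℝ => (semigroupDeriv (t - τ) j (halfSq (u τ)) : L2Complex L₁ L₂))
      volume 0 t := by
  obtain ⟨M, hM⟩ := isCompact_Icc.exists_bound_of_continuousOn hu
  have hne : ∀ᵐ τ : ℝ, τ ≠ t := by simp [ae_iff]
  have hlt : ∀ᵐ τ ∂(volume.restrict (Set.uIoc 0 t)), 0 < τ ∧ τ < t := by
    filter_upwards [ae_restrict_mem measurableSet_uIoc, ae_restrict_of_ae hne] with τ h1 h2
    rw [Set.uIoc_of_le ht] at h1
    exact ⟨h1.1, lt_of_le_of_ne h1.2 h2⟩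
  have hg : IntervalIntegrable
      (fun τ : ℝ => smoothingConst L₁ L₂ * (t - τ) ^ (-(3 / 4) : ℝ) * (M ^ 2 / 2)) volume 0 t :=
    ((intervalIntegrable_sub_rpow t).const_mul _).mul_const _
  refine hg.mono_fun ?_ ?_
  -- Measurability: pointwise limit of the partial Fourier sums, which are continuous in `τ`.
  · refine aestronglyMeasurable_of_tendsto_ae Filter.atTop
      (f := fun (s : Finset (ℤ × ℤ)) (τ : ℝ) =>
        ∑ k ∈ s, (derivSymbol L₁ L₂ (t - τ) j k * coeff (halfSq (u τ)) k) •
          (characterL2 k : L2Complex L₁ L₂)) (fun s => ?_) ?_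
    · refine ContinuousOn.aestronglyMeasurable ?_ measurableSet_uIoc
      rw [Set.uIoc_of_le ht]
      refine continuousOn_finsetSum _ fun k _ => ?_
      have h1 : Continuous fun τ => derivSymbol L₁ L₂ (t - τ) j k :=
        (continuous_derivSymbol j k).comp (continuous_const.sub continuous_id)
      have h2 : ContinuousOn (fun τ => coeff (halfSq (u τ)) k) (Set.Ioc 0 t) :=
        (continuous_coeff_halfSq k).comp_continuousOn (hu.mono Set.Ioc_subset_Icc_self)
      exact (h1.continuousOn.mul h2).smul continuousOn_const
    · filter_upwards [hlt] with τ hτ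
      exact (summable_smul_of_orthonormal orthonormal_characterL2
        (summable_derivSymbol_mul (by linarith [hτ.2]) (by linarith [hτ.1]) j
          (norm_coeff_halfSq_le (u τ)))).hasSum
  · filter_upwards [hlt] with τ hτ
    refine (norm_semigroupDeriv_le (by linarith [hτ.2]) (by linarith [hτ.1]) j (u τ)).trans ?_
    refine le_trans ?_ (Real.le_norm_self _)
    have h1 : 0 ≤ smoothingConst L₁ L₂ * (t - τ) ^ (-(3 / 4) : ℝ) :=
      mul_nonneg smoothingConst_nonneg (Real.rpow_nonneg (by linarith [hτ.2]) _)
    have := hM τ ⟨hτ.1.le, hτ.2.le⟩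
    gcongr

/-- The `j`-th component of the Duhamel integral `∫₀ᵗ e^{-(t-τ)ℒ} ∇(|u(τ)|²/2) dτ`. -/
def duhamel (u : ℝ → L2Field L₁ L₂) (t : ℝ) (j : Fin 2) : L2Complex L₁ L₂ :=
  ∫ τ in (0 : ℝ)..t, semigroupDeriv (t - τ) j (halfSq (u τ))

lemma conjL2_duhamel {u : ℝ → L2Field L₁ L₂} {t : ℝ} (ht : 0 ≤ t) (ht1 : t ≤ 1)
    (hu : ContinuousOn u (Set.Icc 0 t)) (j : Fin 2) :
    conjL2 (duhamel u t j) = duhamel u t j := by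
  rw [duhamel, ← conjL2.intervalIntegral_comp_comm (intervalIntegrable_semigroupDeriv ht ht1 hu j)]
  have hne : ∀ᵐ τ : ℝ, τ ≠ t := by simp [ae_iff]
  refine intervalIntegral.integral_congr_ae ?_
  filter_upwards [hne] with τ h1 h2
  rw [Set.uIoc_of_le ht] at h2
  exact conjL2_semigroupDeriv (sub_pos.2 (lt_of_le_of_ne h2.2 h1)) (by linarith [h2.1]) j (u τ)

/-- The Duhamel integral is the sum of its own Fourier series. -/
lemma duhamel_eq_tsum {u : ℝ → L2Field L₁ L₂} {t : ℝ} (ht : 0 ≤ t) (ht1 : t ≤ 1)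
    (hu : ContinuousOn u (Set.Icc 0 t)) (j : Fin 2) :
    duhamel u t j = ∑' k, (∫ τ in (0 : ℝ)..t,
      derivSymbol L₁ L₂ (t - τ) j k * coeff (halfSq (u τ)) k) • characterL2 k := by
  have hne : ∀ᵐ τ : ℝ, τ ≠ t := by simp [ae_iff]
  refine intervalIntegral_eq_tsum_smul orthonormal_characterL2
    (intervalIntegrable_semigroupDeriv ht ht1 hu j) (c := fun τ k =>
      derivSymbol L₁ L₂ (t - τ) j k * coeff (halfSq (u τ)) k) ?_
  filter_upwards [hne] with τ h1 h2
  rw [Set.uIoc_of_le ht] at h2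
  exact ⟨summable_derivSymbol_mul (sub_pos.2 (lt_of_le_of_ne h2.2 h1)) (by linarith [h2.1]) j
    (norm_coeff_halfSq_le (u τ)), rfl⟩

lemma norm_coeff_duhamel_le {u : ℝ → L2Field L₁ L₂} {t R : ℝ} (ht : 0 ≤ t) (ht1 : t ≤ 1)
    (hu : ContinuousOn u (Set.Icc 0 t)) (hR : ∀ τ ∈ Set.Icc 0 t, ‖u τ‖ ≤ R) (j : Fin 2)
    (k : ℤ × ℤ) :
    ‖coeff (duhamel u t j) k‖ ≤ 2 * R ^ 2 * waveSq L₁ L₂ k ^ (-(3 / 2) : ℝ) := by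
  have hb : ∀ k, ‖∫ τ in (0 : ℝ)..t, derivSymbol L₁ L₂ (t - τ) j k * coeff (halfSq (u τ)) k‖
      ≤ 2 * R ^ 2 * waveSq L₁ L₂ k ^ (-(3 / 2) : ℝ) := by
    intro k
    refine (norm_integral_derivSymbol_mul_le ht ht1 j k (A := R ^ 2 / 2) (by positivity)
      fun τ hτ => (norm_coeff_halfSq_le (u τ) k).trans ?_).trans_eq (by ring)
    have := hR τ hτ
    gcongr
  rw [duhamel_eq_tsum ht ht1 hu, coeff_tsum_smul]
  · exact hb k
  · exact (summable_sq_const_mul_waveSq_rpow (Fact.out : 0 < L₁) (Fact.out : 0 < L₂)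
      (2 * R ^ 2)).of_nonneg_of_le (fun k => by positivity)
      fun k => pow_le_pow_left₀ (norm_nonneg _) (hb k) 2

lemma continuousOn_duhamel {u : ℝ → L2Field L₁ L₂} (hu : Continuous u) (j : Fin 2) :
    ContinuousOn (fun t => duhamel u t j) (Set.Icc 0 1) := by
  obtain ⟨R, hR⟩ := (isCompact_Icc (a := (0 : ℝ)) (b := 1)).exists_bound_of_continuousOn
    hu.continuousOn
  rw [continuousOn_iff_continuous_domRestrict]
  have h := continuous_tsum_smul (orthonormal_characterL2 (L₁ := L₁) (L₂ := L₂))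
    (X := Set.Icc (0 : ℝ) 1) (b := fun k => 4 * (R ^ 2 / 2) * waveSq L₁ L₂ k ^ (-(3 / 2) : ℝ))
    (c := fun k (t : Set.Icc (0 : ℝ) 1) => ∫ τ in (0 : ℝ)..t,
      derivSymbol L₁ L₂ (t - τ) j k * coeff (halfSq (u τ)) k)
    (fun k => (continuous_integral_derivSymbol_mul j k
      ((continuous_coeff_halfSq k).comp hu)).comp continuous_subtype_val)
    (summable_sq_const_mul_waveSq_rpow Fact.out Fact.out _)
    (fun k t => norm_integral_derivSymbol_mul_le t.2.1 t.2.2 j k (by positivity) fun τ hτ => by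
      refine (norm_coeff_halfSq_le (u τ) k).trans ?_
      have := hR τ ⟨hτ.1, hτ.2.trans t.2.2⟩
      gcongr)
  refine h.congr fun t => ?_
  exact (duhamel_eq_tsum t.2.1 t.2.2 hu.continuousOn j).symm

/-- The basic estimate behind both the contraction (`g` constant) and uniqueness
(`g` exponential). -/
lemma norm_duhamel_sub_le {u v : ℝ → L2Field L₁ L₂} {t R : ℝ} (ht : 0 ≤ t) (ht1 : t ≤ 1)
    (hu : ContinuousOn u (Set.Icc 0 t)) (hv : ContinuousOn v (Set.Icc 0 t))
    (hRu : ∀ τ ∈ Set.Icc 0 t, ‖u τ‖ ≤ R) (hRv : ∀ τ ∈ Set.Icc 0 t, ‖v τ‖ ≤ R)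
    {g : ℝ → ℝ} (hg : Continuous g) (hg0 : ∀ τ ∈ Set.Icc 0 t, ‖u τ - v τ‖ ≤ g τ) (j : Fin 2) :
    ‖duhamel u t j - duhamel v t j‖
      ≤ smoothingConst L₁ L₂ * R * ∫ τ in (0 : ℝ)..t, (t - τ) ^ (-(3 / 4) : ℝ) * g τ := by
  have hne : ∀ᵐ τ : ℝ, τ ≠ t := by simp [ae_iff]
  rw [duhamel, duhamel, ← intervalIntegral.integral_sub
    (intervalIntegrable_semigroupDeriv ht ht1 hu j)
    (intervalIntegrable_semigroupDeriv ht ht1 hv j), ← intervalIntegral.integral_const_mul]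
  refine intervalIntegral.norm_integral_le_of_norm_le ht ?_
    (((intervalIntegrable_sub_rpow t).mul_continuousOn hg.continuousOn).const_mul _)
  filter_upwards [hne] with τ h1 h2
  have hpos : 0 < t - τ := sub_pos.2 (lt_of_le_of_ne h2.2 h1)
  have hm : τ ∈ Set.Icc 0 t := ⟨h2.1.le, h2.2⟩
  refine (norm_semigroupDeriv_sub_le hpos (by linarith [h2.1]) j (u τ) (v τ)).trans ?_
  have h3 : ‖u τ - v τ‖ * ‖u τ + v τ‖ / 2 ≤ R * g τ := by
    have h4 : ‖u τ + v τ‖ ≤ 2 * R := by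
      linarith [norm_add_le (u τ) (v τ), hRu τ hm, hRv τ hm]
    have h5 := mul_le_mul (hg0 τ hm) h4 (norm_nonneg _) ((norm_nonneg _).trans (hg0 τ hm))
    linarith
  calc _ ≤ smoothingConst L₁ L₂ * (t - τ) ^ (-(3 / 4) : ℝ) * (R * g τ) :=
        mul_le_mul_of_nonneg_left h3 (mul_nonneg smoothingConst_nonneg (by positivity))
    _ = _ := by ring

end Duhamel

section WellPosedness

variable {L₁ L₂ : ℝ} [Fact (0 < L₁)] [Fact (0 < L₂)]

/-! ### Existence by contraction -/

lemma duhamel_zero (t : ℝ) (j : Fin 2) :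
    duhamel (fun _ => (0 : L2Field L₁ L₂)) t j = 0 := by
  have h : ∀ k, coeff (halfSq (0 : L2Field L₁ L₂)) k = 0 := fun k => by
    simpa using norm_coeff_halfSq_le (0 : L2Field L₁ L₂) k
  simp [duhamel, semigroupDeriv, multiplier, h]

lemma norm_duhamel_sub_le_const {u v : ℝ → L2Field L₁ L₂} {t T R δ : ℝ} (ht : t ∈ Set.Icc 0 T)
    (hT1 : T ≤ 1) (hu : Continuous u) (hv : Continuous v) (hRu : ∀ τ, ‖u τ‖ ≤ R)
    (hRv : ∀ τ, ‖v τ‖ ≤ R) (hδ : ∀ τ, ‖u τ - v τ‖ ≤ δ) (j : Fin 2) :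
    ‖duhamel u t j - duhamel v t j‖
      ≤ 4 * smoothingConst L₁ L₂ * R * δ * T ^ (1 / 4 : ℝ) := by
  have hR0 : 0 ≤ R := (norm_nonneg _).trans (hRu 0)
  have hδ0 : 0 ≤ δ := (norm_nonneg _).trans (hδ 0)
  have h := norm_duhamel_sub_le ht.1 (ht.2.trans hT1) hu.continuousOn hv.continuousOn
    (fun τ _ => hRu τ) (fun τ _ => hRv τ) (g := fun _ => δ) continuous_const (fun τ _ => hδ τ) j
  rw [intervalIntegral.integral_mul_const, integral_sub_rpow] at h
  have h1 : t ^ (1 / 4 : ℝ) ≤ T ^ (1 / 4 : ℝ) := Real.rpow_le_rpow ht.1 ht.2 (by norm_num)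
  have hK : 0 ≤ smoothingConst L₁ L₂ := smoothingConst_nonneg
  calc _ ≤ _ := h
    _ = 4 * smoothingConst L₁ L₂ * R * δ * t ^ (1 / 4 : ℝ) := by ring
    _ ≤ _ := by gcongr

/-- The right-hand side of the Duhamel formula, recombined into a real vector field. -/
def duhamelMap (u₀ : L2Field L₁ L₂) (u : ℝ → L2Field L₁ L₂) (t : ℝ) : L2Field L₁ L₂ :=
  toField fun j => semigroup t (component j u₀) - duhamel u t j

lemma continuousOn_duhamelMap (u₀ : L2Field L₁ L₂) {u : ℝ → L2Field L₁ L₂} (hu : Continuous u) :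
    ContinuousOn (duhamelMap u₀ u) (Set.Icc 0 1) := by
  refine continuous_toField.comp_continuousOn (continuousOn_pi.2 fun j => ?_)
  exact (continuousOn_semigroup _).sub (continuousOn_duhamel hu j)

lemma component_duhamelMap (u₀ : L2Field L₁ L₂) {u : ℝ → L2Field L₁ L₂} {t : ℝ} (ht : 0 ≤ t)
    (ht1 : t ≤ 1) (hu : ContinuousOn u (Set.Icc 0 t)) (j : Fin 2) :
    component j (duhamelMap u₀ u t) = semigroup t (component j u₀) - duhamel u t j := by
  refine component_toField ?_
  rw [map_sub, conjL2_semigroup_component ht ht1, conjL2_duhamel ht ht1 hu]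

lemma norm_duhamelMap_le (u₀ : L2Field L₁ L₂) {u : ℝ → L2Field L₁ L₂} {t T R : ℝ}
    (ht : t ∈ Set.Icc 0 T) (hT1 : T ≤ 1) (hu : Continuous u) (hR : ∀ τ, ‖u τ‖ ≤ R) :
    ‖duhamelMap u₀ u t‖
      ≤ 4 * ‖u₀‖ + 8 * smoothingConst L₁ L₂ * R ^ 2 * T ^ (1 / 4 : ℝ) := by
  have hj : ∀ j, ‖semigroup t (component j u₀) - duhamel u t j‖
      ≤ 2 * ‖u₀‖ + 4 * smoothingConst L₁ L₂ * R ^ 2 * T ^ (1 / 4 : ℝ) := by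
    intro j
    have h1 := (norm_semigroup_le ht.1 (ht.2.trans hT1) (component j u₀)).trans
      (mul_le_mul_of_nonneg_left (norm_component_le j u₀) zero_le_two)
    have h2 := norm_duhamel_sub_le_const ht hT1 hu (v := fun _ => 0) continuous_const hR
      (fun _ => by simpa using (norm_nonneg _).trans (hR 0)) (δ := R)
      (fun τ => by simpa using hR τ) j
    rw [duhamel_zero, sub_zero] at h2
    refine (norm_sub_le _ _).trans (add_le_add h1 (h2.trans_eq (by ring)))
  refine (norm_toField_le _).trans ?_
  rw [Fin.sum_univ_two]
  linarith [hj 0, hj 1]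

lemma norm_duhamelMap_sub_le (u₀ : L2Field L₁ L₂) {u v : ℝ → L2Field L₁ L₂} {t T R δ : ℝ}
    (ht : t ∈ Set.Icc 0 T) (hT1 : T ≤ 1) (hu : Continuous u) (hv : Continuous v)
    (hRu : ∀ τ, ‖u τ‖ ≤ R) (hRv : ∀ τ, ‖v τ‖ ≤ R) (hδ : ∀ τ, ‖u τ - v τ‖ ≤ δ) :
    ‖duhamelMap u₀ u t - duhamelMap u₀ v t‖
      ≤ 8 * smoothingConst L₁ L₂ * R * δ * T ^ (1 / 4 : ℝ) := by
  rw [duhamelMap, duhamelMap, toField_sub]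
  refine (norm_toField_le _).trans ?_
  have h := fun j => norm_duhamel_sub_le_const ht hT1 hu hv hRu hRv hδ j
  have hj : ∀ j, ‖((fun j => semigroup t (component j u₀) - duhamel u t j)
      - fun j => semigroup t (component j u₀) - duhamel v t j) j‖
      ≤ 4 * smoothingConst L₁ L₂ * R * δ * T ^ (1 / 4 : ℝ) := by
    intro j
    rw [Pi.sub_apply, sub_sub_sub_cancel_left, norm_sub_rev]
    exact h j
  rw [Fin.sum_univ_two]
  linarith [hj 0, hj 1]

/-- The Duhamel map has a fixed point in the ball of radius `4‖u₀‖ + 1`, on a time interval whose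
length makes it a contraction of ratio `1/2` of that ball. -/
lemma exists_fixedPoint_duhamelMap (u₀ : L2Field L₁ L₂) :
    ∃ T : ℝ, 0 < T ∧ T ≤ 1 ∧ ∃ u : ℝ → L2Field L₁ L₂, Continuous u ∧
      (∀ t, ‖u t‖ ≤ 4 * ‖u₀‖ + 1) ∧ ∀ t ∈ Set.Icc 0 T, u t = duhamelMap u₀ u t := by
  set R : ℝ := 4 * ‖u₀‖ + 1 with hR
  set K : ℝ := smoothingConst L₁ L₂ with hK
  have hK0 : 0 ≤ K := smoothingConst_nonneg
  have hR1 : 1 ≤ R := by linarith [norm_nonneg u₀]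
  -- `a = T ^ (1 / 4)`: both the self-map bound and the contraction ratio are linear in `a`.
  set a : ℝ := 1 / (1 + 16 * K * R ^ 2) with ha
  have hapos : 0 < a := by positivity
  have ha1 : a ≤ 1 := by
    rw [ha, div_le_one (by positivity)]
    linarith [show 0 ≤ 16 * K * R ^ 2 by positivity]
  have hT4 : (a ^ 4) ^ (1 / 4 : ℝ) = a := by
    rw [← Real.rpow_natCast, ← Real.rpow_mul hapos.le]
    norm_num
  have haK : 8 * K * R ^ 2 * a ≤ 1 / 2 := by
    rw [ha, mul_one_div, div_le_iff₀ (by positivity)]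
    linarith
  have hT0 : 0 < a ^ 4 := by positivity
  have hT1 : a ^ 4 ≤ 1 := pow_le_one₀ hapos.le ha1
  generalize hTdef : a ^ 4 = T at hT4 hT0 hT1
  refine ⟨T, hT0, hT1, ?_⟩
  have hext : ∀ U : C(Set.Icc (0 : ℝ) T, L2Field L₁ L₂),
      Continuous (Set.IccExtend hT0.le U) := fun U => U.continuous.Icc_extend'
  let Φ : C(Set.Icc (0 : ℝ) T, L2Field L₁ L₂) → C(Set.Icc (0 : ℝ) T, L2Field L₁ L₂) := fun U =>
    ⟨fun t => duhamelMap u₀ (Set.IccExtend hT0.le U) t,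
      ((continuousOn_duhamelMap u₀ (hext U)).mono
        (Set.Icc_subset_Icc_right hT1)).domRestrict⟩
  have hle : ∀ U : C(Set.Icc (0 : ℝ) T, L2Field L₁ L₂), U ∈ Metric.closedBall 0 R →
      ∀ τ, ‖Set.IccExtend hT0.le U τ‖ ≤ R := fun U hU τ =>
    (U.norm_coe_le_norm _).trans (by simpa using hU)
  have hmaps : Set.MapsTo Φ (Metric.closedBall 0 R) (Metric.closedBall 0 R) := by
    intro U hU
    rw [mem_closedBall_zero_iff, ContinuousMap.norm_le _ (by linarith)]
    intro t
    have h := norm_duhamelMap_le u₀ t.2 hT1 (hext U) (hle U hU)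
    rw [hT4] at h
    exact h.trans (by linarith)
  have hcontr : ContractingWith (1 / 2) (hmaps.restrict Φ _ _) := by
    refine ⟨by norm_num, LipschitzWith.of_dist_le_mul ?_⟩
    rintro ⟨U, hU⟩ ⟨V, hV⟩
    rw [Subtype.dist_eq, Subtype.dist_eq, dist_eq_norm, dist_eq_norm]
    change ‖Φ U - Φ V‖ ≤ _ * ‖U - V‖
    rw [ContinuousMap.norm_le _ (by positivity)]
    intro t
    have h := norm_duhamelMap_sub_le u₀ t.2 hT1 (hext U) (hext V) (hle U hU) (hle V hV)
      (δ := ‖U - V‖) (fun τ => (U - V).norm_coe_le_norm _)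
    rw [hT4] at h
    refine h.trans ?_
    have h2 : 8 * K * R * a ≤ 1 / 2 := by
      refine le_trans ?_ haK
      have : R ≤ R ^ 2 := by nlinarith
      gcongr
    calc _ = 8 * K * R * a * ‖U - V‖ := by ring
      _ ≤ 1 / 2 * ‖U - V‖ := by gcongr
      _ = _ := by simp
  obtain ⟨U, hU, hfix, -⟩ := ContractingWith.exists_fixedPoint'
    Metric.isClosed_closedBall.isComplete hmaps hcontr
    (Metric.mem_closedBall_self (by linarith)) (edist_ne_top _ _)
  refine ⟨Set.IccExtend hT0.le U, hext U, hle U hU, fun t ht => ?_⟩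
  have h := congrArg (fun W : C(Set.Icc (0 : ℝ) T, L2Field L₁ L₂) => W ⟨t, ht⟩) hfix
  rw [Set.IccExtend_of_mem _ _ ht]
  exact h.symm

/-! ### Uniqueness -/

/-- Two mild solutions agree: in the norm `sup_τ e^{-λτ} ‖·‖`, with `λ` large, the Duhamel integral
contracts differences, whatever the size of the solutions. -/
lemma IsMildSolution.eqOn {u₀ : L2Field L₁ L₂} {u v : ℝ → L2Field L₁ L₂} {T : ℝ} (hT1 : T ≤ 1)
    (hu : IsMildSolution T u₀ u) (hv : IsMildSolution T u₀ v) : Set.EqOn u v (Set.Ico 0 T) := by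
  intro t₁ ht₁
  have hsub : Set.Icc 0 t₁ ⊆ Set.Ico 0 T := fun τ hτ => ⟨hτ.1, hτ.2.trans_lt ht₁.2⟩
  have hcu := hu.continuousOn.mono hsub
  have hcv := hv.continuousOn.mono hsub
  obtain ⟨R₁, hR₁⟩ := isCompact_Icc.exists_bound_of_continuousOn hcu
  obtain ⟨R₂, hR₂⟩ := isCompact_Icc.exists_bound_of_continuousOn hcv
  set R := max R₁ R₂ with hR
  have hR0 : 0 ≤ R := (norm_nonneg _).trans ((hR₁ 0 ⟨le_rfl, ht₁.1⟩).trans (le_max_left _ _))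
  set K : ℝ := smoothingConst L₁ L₂ with hK
  have hK0 : 0 ≤ K := smoothingConst_nonneg
  set G : ℝ := Real.Gamma (1 / 4) with hG
  have hG0 : 0 < G := Real.Gamma_pos_of_pos (by norm_num)
  set c : ℝ := 2 * K * R * G with hc
  have hc0 : 0 ≤ c := by positivity
  -- With this `λ` the weighted norm of the kernel is `c / (c + 1) < 1`.
  set lam : ℝ := (c + 1) ^ 4 with hlam
  have hlam0 : 0 < lam := by positivity
  have hlam4 : (1 / lam) ^ (1 / 4 : ℝ) = 1 / (c + 1) := by
    rw [hlam, ← one_div_pow, ← Real.rpow_natCast, ← Real.rpow_mul (by positivity)]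
    norm_num
  have hcont : ContinuousOn (fun τ => Real.exp (-(lam * τ)) * ‖u τ - v τ‖) (Set.Icc 0 t₁) := by
    have := (hcu.sub hcv).norm
    fun_prop
  obtain ⟨s, hs, hmax⟩ := isCompact_Icc.exists_isMaxOn ⟨0, le_rfl, ht₁.1⟩ hcont
  set N := Real.exp (-(lam * s)) * ‖u s - v s‖ with hN
  have hN0 : 0 ≤ N := by positivity
  have hNle : ∀ τ ∈ Set.Icc 0 t₁, ‖u τ - v τ‖ ≤ N * Real.exp (lam * τ) := by
    intro τ hτ
    have h1 : Real.exp (-(lam * τ)) * ‖u τ - v τ‖ ≤ N := hmax hτ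
    rwa [Real.exp_neg, inv_mul_le_iff₀ (Real.exp_pos _), mul_comm] at h1
  have hs1 : s ≤ 1 := (hsub hs).2.le.trans hT1
  have hss : Set.Icc 0 s ⊆ Set.Icc 0 t₁ := Set.Icc_subset_Icc_right hs.2
  have hj : ∀ j, ‖component j (u s) - component j (v s)‖
      ≤ K * R * (N * (Real.exp (lam * s) * (1 / (c + 1) * G))) := by
    intro j
    rw [hu.duhamel s (hsub hs) j, hv.duhamel s (hsub hs) j, sub_sub_sub_cancel_left, norm_sub_rev]
    refine (norm_duhamel_sub_le hs.1 hs1 (hcu.mono hss) (hcv.mono hss)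
      (fun τ hτ => (hR₁ τ (hss hτ)).trans (le_max_left _ _))
      (fun τ hτ => (hR₂ τ (hss hτ)).trans (le_max_right _ _))
      (g := fun τ => N * Real.exp (lam * τ)) (by fun_prop) (fun τ hτ => hNle τ (hss hτ)) j).trans ?_
    have h2 := integral_sub_rpow_mul_exp_le hs.1 hlam0
    rw [hlam4] at h2
    have h3 : ∀ τ, (s - τ) ^ (-(3 / 4) : ℝ) * (N * Real.exp (lam * τ))
        = N * ((s - τ) ^ (-(3 / 4) : ℝ) * Real.exp (lam * τ)) := fun τ => by ring
    simp only [h3, intervalIntegral.integral_const_mul]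
    gcongr
  have hfin : N ≤ c / (c + 1) * N := by
    have h4 := norm_sub_le_sum_component (u s) (v s)
    rw [Fin.sum_univ_two] at h4
    have h5 : ‖u s - v s‖ ≤ Real.exp (lam * s) * (c / (c + 1) * N) := by
      refine (h4.trans (add_le_add (hj 0) (hj 1))).trans_eq ?_
      rw [hc]; ring
    rw [hN, Real.exp_neg, inv_mul_le_iff₀ (Real.exp_pos _), ← Real.exp_neg, ← hN]
    exact h5
  have hNz : N ≤ 0 := by
    rw [div_mul_eq_mul_div, le_div_iff₀ (by positivity)] at hfin
    linarith
  have h6 := hNle t₁ ⟨ht₁.1, le_rfl⟩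
  rw [le_antisymm hNz hN0, zero_mul] at h6
  exact sub_eq_zero.1 (norm_le_zero_iff.1 h6)

end WellPosedness

/-! ### Regularity of the solution -/

section Regularity

variable {L₁ L₂ : ℝ}

lemma rpow_le_exp {x p : ℝ} (hx : 0 ≤ x) (hp0 : 0 ≤ p) (hp1 : p ≤ 1) : x ^ p ≤ Real.exp x := by
  rcases le_total x 1 with h | h
  · exact (Real.rpow_le_one hx h hp0).trans (Real.one_le_exp hx)
  · calc x ^ p ≤ x ^ (1 : ℝ) := Real.rpow_le_rpow_of_exponent_le h hp1
      _ = x := Real.rpow_one x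
      _ ≤ Real.exp x := by linarith [Real.add_one_le_exp x]

lemma rpow_mul_waveSq_rpow_mul_exp_le {s t : ℝ} (hs0 : 0 ≤ s) (hs2 : s ≤ 2) (ht : 0 ≤ t)
    (ht1 : t ≤ 1) (k : ℤ × ℤ) :
    t ^ (s / 2) * waveSq L₁ L₂ k ^ s * Real.exp (-t * symbol L₁ L₂ k) ^ 2 ≤ Real.exp 1 := by
  set q := waveSq L₁ L₂ k with hq
  have hq0 : 0 ≤ q := waveSq_nonneg k
  have h1 : t ^ (s / 2) * q ^ s = (t * q ^ 2) ^ (s / 2) := by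
    rw [Real.mul_rpow ht (by positivity), ← Real.rpow_natCast q 2, ← Real.rpow_mul hq0]
    congr 2
    push_cast; ring
  have h2 := exp_neg_mul_symbol_sq_le (L₁ := L₁) (L₂ := L₂) ht ht1 k
  have h3 := rpow_le_exp (x := t * q ^ 2) (p := s / 2) (by positivity) (by linarith) (by linarith)
  rw [h1]
  calc _ ≤ Real.exp (t * q ^ 2) * (Real.exp 1 * Real.exp (-(t * q ^ 2))) :=
        mul_le_mul h3 h2 (sq_nonneg _) (Real.exp_pos _).le
    _ = Real.exp 1 := by
        rw [← Real.exp_add, ← Real.exp_add]; congr 1; ring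

lemma waveSq_rpow_mul_sq_le {s : ℝ} (k : ℤ × ℤ) :
    waveSq L₁ L₂ k ^ s * (waveSq L₁ L₂ k ^ (-(3 / 2) : ℝ)) ^ 2
      ≤ waveSq L₁ L₂ k ^ (-(3 - s)) := by
  set q := waveSq L₁ L₂ k with hq
  have hq0 : 0 ≤ q := waveSq_nonneg k
  rcases hq0.eq_or_lt with h0 | hpos
  · rw [← h0, Real.zero_rpow (by norm_num : (-(3 / 2) : ℝ) ≠ 0)]
    simpa using Real.rpow_nonneg le_rfl _
  · rw [← Real.rpow_natCast (q ^ (-(3 / 2) : ℝ)) 2, ← Real.rpow_mul hq0, ← Real.rpow_add hpos]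
    refine le_of_eq ?_
    congr 1
    push_cast; ring

variable [Fact (0 < L₁)] [Fact (0 < L₂)]

lemma coeffSq_nonneg (w : L2Field L₁ L₂) (k : ℤ × ℤ) : 0 ≤ coeffSq w k := by
  unfold coeffSq; positivity

lemma summable_coeffSq (w : L2Field L₁ L₂) : Summable (coeffSq w) :=
  summable_sum fun j _ => summable_coeff_sq (component j w)

lemma memHs_of_summable {s : ℝ} (hs : 0 ≤ s) {w : L2Field L₁ L₂}
    (h : Summable fun k => waveSq L₁ L₂ k ^ s * coeffSq w k) : MemHs s w := by
  refine (((summable_coeffSq w).add h).mul_left (2 ^ s)).of_nonneg_of_le (fun k =>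
    mul_nonneg (Real.rpow_nonneg (by linarith [waveSq_nonneg (L₁ := L₁) (L₂ := L₂) k]) _)
      (coeffSq_nonneg w k)) fun k => ?_
  set q := waveSq L₁ L₂ k with hq
  have hq0 : 0 ≤ q := waveSq_nonneg k
  have h1 : (1 + q) ^ s ≤ 2 ^ s * (1 + q ^ s) := by
    rcases le_total q 1 with hle | hle
    · calc (1 + q) ^ s ≤ 2 ^ s := Real.rpow_le_rpow (by linarith) (by linarith) hs
        _ ≤ 2 ^ s * (1 + q ^ s) := le_mul_of_one_le_right (by positivity)
            (by linarith [Real.rpow_nonneg hq0 s])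
    · calc (1 + q) ^ s ≤ (2 * q) ^ s := Real.rpow_le_rpow (by linarith) (by linarith) hs
        _ = 2 ^ s * q ^ s := Real.mul_rpow zero_le_two hq0
        _ ≤ 2 ^ s * (1 + q ^ s) := by gcongr; linarith
  calc _ ≤ 2 ^ s * (1 + q ^ s) * coeffSq w k :=
        mul_le_mul_of_nonneg_right h1 (coeffSq_nonneg w k)
    _ = _ := by ring

/-- The sum of a free evolution and a term whose Fourier coefficients are `O(|k̃|⁻³)`, as those of
the Duhamel integral are, lies in `H^s` for all `s < 2`. -/
lemma memHs_and_homNorm_le {s t r B : ℝ} (hs0 : 0 ≤ s) (hs2 : s < 2) (ht : 0 < t) (ht1 : t ≤ 1)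
    {w : L2Field L₁ L₂} {f d : Fin 2 → L2Complex L₁ L₂} (hf : ∀ j, ‖f j‖ ≤ r)
    (hd : ∀ j k, ‖coeff (d j) k‖ ≤ B * waveSq L₁ L₂ k ^ (-(3 / 2) : ℝ))
    (hw : ∀ j, component j w = semigroup t (f j) - d j) :
    MemHs s w ∧ t ^ (s / 4) * homNorm s w
      ≤ √(4 * Real.exp 1 * r ^ 2 + 4 * B ^ 2 * ∑' k : ℤ × ℤ, waveSq L₁ L₂ k ^ (-(3 - s))) := by
  have hS := summable_waveSq_rpow (Fact.out : 0 < L₁) (Fact.out : 0 < L₂) (p := 3 - s)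
    (by linarith)
  set g : ℤ × ℤ → ℝ := fun k => 2 * Real.exp 1 * ∑ j, ‖coeff (f j) k‖ ^ 2
    + 4 * B ^ 2 * waveSq L₁ L₂ k ^ (-(3 - s)) with hg
  have hF : Summable fun k => ∑ j, ‖coeff (f j) k‖ ^ 2 :=
    summable_sum fun j _ => summable_coeff_sq (f j)
  have hgs : Summable g := (hF.mul_left _).add (hS.mul_left _)
  have hgsum : ∑' k, g k ≤ 4 * Real.exp 1 * r ^ 2
      + 4 * B ^ 2 * ∑' k : ℤ × ℤ, waveSq L₁ L₂ k ^ (-(3 - s)) := by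
    rw [hg, (hF.mul_left _).tsum_add (hS.mul_left _), tsum_mul_left, tsum_mul_left,
      Summable.tsum_finsetSum fun j _ => summable_coeff_sq (f j), Fin.sum_univ_two]
    have h1 : ∀ j, ∑' k, ‖coeff (f j) k‖ ^ 2 ≤ r ^ 2 := fun j =>
      (tsum_coeff_sq_le (f j)).trans (pow_le_pow_left₀ (norm_nonneg _) (hf j) 2)
    have h2 := Real.exp_pos 1
    nlinarith [h1 0, h1 1, mul_le_mul_of_nonneg_left (add_le_add (h1 0) (h1 1)) h2.le]
  have htp : 0 < t ^ (s / 2) := by positivity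
  have hle : ∀ k, t ^ (s / 2) * (waveSq L₁ L₂ k ^ s * coeffSq w k) ≤ g k := by
    intro k
    set q := waveSq L₁ L₂ k with hq
    set E := Real.exp (-t * symbol L₁ L₂ k) with hE
    have hq0 : 0 ≤ q ^ s := Real.rpow_nonneg (waveSq_nonneg k) _
    have hj : ∀ j, t ^ (s / 2) * (q ^ s * ‖coeff (component j w) k‖ ^ 2)
        ≤ 2 * Real.exp 1 * ‖coeff (f j) k‖ ^ 2 + 2 * B ^ 2 * q ^ (-(3 - s)) := by
      intro j
      have h1 : ‖coeff (component j w) k‖ ≤ E * ‖coeff (f j) k‖ + B * q ^ (-(3 / 2) : ℝ) := by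
        rw [hw, coeff_sub, coeff_semigroup ht.le ht1]
        refine (norm_sub_le _ _).trans (add_le_add (le_of_eq ?_) (hd j k))
        rw [norm_mul, Complex.norm_real, Real.norm_of_nonneg (Real.exp_pos _).le]
      have h2 : ‖coeff (component j w) k‖ ^ 2
          ≤ 2 * (E ^ 2 * ‖coeff (f j) k‖ ^ 2) + 2 * (B ^ 2 * (q ^ (-(3 / 2) : ℝ)) ^ 2) := by
        refine (pow_le_pow_left₀ (norm_nonneg _) h1 2).trans ?_
        nlinarith [sq_nonneg (E * ‖coeff (f j) k‖ - B * q ^ (-(3 / 2) : ℝ))]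
      have h3 := rpow_mul_waveSq_rpow_mul_exp_le (L₁ := L₁) (L₂ := L₂) hs0 hs2.le ht.le ht1 k
      have h4 := waveSq_rpow_mul_sq_le (L₁ := L₁) (L₂ := L₂) (s := s) k
      have h5 : t ^ (s / 2) ≤ 1 := Real.rpow_le_one ht.le ht1 (by linarith)
      calc _ ≤ t ^ (s / 2) * (q ^ s * (2 * (E ^ 2 * ‖coeff (f j) k‖ ^ 2)
              + 2 * (B ^ 2 * (q ^ (-(3 / 2) : ℝ)) ^ 2))) := by gcongr
        _ = 2 * (t ^ (s / 2) * q ^ s * E ^ 2) * ‖coeff (f j) k‖ ^ 2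
              + 2 * B ^ 2 * (t ^ (s / 2) * (q ^ s * (q ^ (-(3 / 2) : ℝ)) ^ 2)) := by ring
        _ ≤ 2 * Real.exp 1 * ‖coeff (f j) k‖ ^ 2
              + 2 * B ^ 2 * (1 * q ^ (-(3 - s))) := by gcongr
        _ = _ := by ring
    have h6 := add_le_add (hj 0) (hj 1)
    simp only [coeffSq, hg, Fin.sum_univ_two]
    linarith
  have hnn : ∀ k, 0 ≤ waveSq L₁ L₂ k ^ s * coeffSq w k := fun k =>
    mul_nonneg (Real.rpow_nonneg (waveSq_nonneg k) _) (coeffSq_nonneg w k)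
  have hsum : Summable fun k => t ^ (s / 2) * (waveSq L₁ L₂ k ^ s * coeffSq w k) :=
    hgs.of_nonneg_of_le (fun k => mul_nonneg htp.le (hnn k)) hle
  have hsum' : Summable fun k => waveSq L₁ L₂ k ^ s * coeffSq w k :=
    (summable_mul_left_iff htp.ne').1 hsum
  refine ⟨memHs_of_summable hs0 hsum', ?_⟩
  have h4 : t ^ (s / 4) = √(t ^ (s / 2)) := by
    rw [Real.sqrt_eq_rpow, ← Real.rpow_mul ht.le]
    congr 1; ring
  rw [h4, homNorm, ← Real.sqrt_mul htp.le]
  refine Real.sqrt_le_sqrt (le_trans ?_ hgsum)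
  calc _ ≤ t ^ (s / 2) * ∑' k, waveSq L₁ L₂ k ^ s * coeffSq w k := by
        gcongr
        exact hsum'.tsum_subtype_le (fun k => waveSq L₁ L₂ k ^ s * coeffSq w k) {k | k ≠ 0} hnn
    _ = ∑' k, t ^ (s / 2) * (waveSq L₁ L₂ k ^ s * coeffSq w k) := tsum_mul_left.symm
    _ ≤ _ := hsum.tsum_le_tsum hle hgs

end Regularity

end KS2D

end

theorem theorem4p1 (L₁ L₂ : ℝ) [Fact (0 < L₁)] [Fact (0 < L₂)] :
    ∃ C : ℝ → ℝ → ℝ, ∀ u₀ : KS2D.L2Field L₁ L₂, ∃ T : ℝ, 0 < T ∧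
      ∃ u : ℝ → KS2D.L2Field L₁ L₂,
        KS2D.IsMildSolution T u₀ u ∧
        (∀ v : ℝ → KS2D.L2Field L₁ L₂,
          KS2D.IsMildSolution T u₀ v → Set.EqOn v u (Set.Ico 0 T)) ∧
        ∀ s : ℝ, 0 ≤ s → s < 5 / 3 → ∀ t ∈ Set.Ioo 0 T,
          KS2D.MemHs s (u t) ∧
          Real.exp (-t) * t ^ (s / 4) * KS2D.homNorm s (u t) ≤ C s ‖u₀‖ := by
  refine ⟨fun s r => √(4 * Real.exp 1 * r ^ 2 + 4 * (2 * (4 * r + 1) ^ 2) ^ 2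
    * ∑' k : ℤ × ℤ, KS2D.waveSq L₁ L₂ k ^ (-(3 - s))), fun u₀ => ?_⟩
  obtain ⟨T, hT0, hT1, u, hu, hR, hfix⟩ := KS2D.exists_fixedPoint_duhamelMap u₀
  have hcomp : ∀ t ∈ Set.Icc 0 T, ∀ j, KS2D.component j (u t)
      = KS2D.semigroup t (KS2D.component j u₀) - KS2D.duhamel u t j := fun t ht j =>
    (congrArg (KS2D.component j) (hfix t ht)).trans
      (KS2D.component_duhamelMap u₀ ht.1 (ht.2.trans hT1) hu.continuousOn j)
  have hmild : KS2D.IsMildSolution T u₀ u :=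
    ⟨hu.continuousOn, fun t ht j => KS2D.intervalIntegrable_semigroupDeriv ht.1
      (ht.2.le.trans hT1) hu.continuousOn j, fun t ht j => hcomp t ⟨ht.1, ht.2.le⟩ j⟩
  refine ⟨T, hT0, u, hmild, fun v hv => hv.eqOn hT1 hmild, fun s hs0 hs t ht => ?_⟩
  have ht1 : t ≤ 1 := ht.2.le.trans hT1
  obtain ⟨h1, h2⟩ := KS2D.memHs_and_homNorm_le hs0 (by linarith) ht.1 ht1
    (fun j => KS2D.norm_component_le j u₀)
    (fun j k => KS2D.norm_coeff_duhamel_le ht.1.le ht1 hu.continuousOn (fun τ _ => hR τ) j k)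
    (hcomp t ⟨ht.1.le, ht.2.le⟩)
  refine ⟨h1, le_trans ?_ h2⟩
  rw [mul_assoc]
  refine mul_le_of_le_one_left (mul_nonneg (Real.rpow_nonneg ht.1.le _) (Real.sqrt_nonneg _)) ?_
  exact Real.exp_le_one_iff.2 (by linarith [ht.1])
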